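/- Let $\mathcal H$ be a separable complex Hilbert space. Consider the Markov master equation $$\partial_t P_{\tau,t}(B)=\Phi_t(P_{\tau,t}(B))-G_t^*P_{\tau,t}(B)-P_{\tau,t}(B)G_t,\qquad P_{\tau,\tau}(B)=B,\qquad 0\le\tau\le t,\qquad(1.1)$$ with $G_t=\tfrac12\Phi_t(I)+iH_t$, $H_t$ densely defined and symmetric, under the following domain and continuity assumptions (all times are $\ge 0$). (a) There is a strongly continuous evolution system of contractions $W_{s,t}\in\mathcal B(\mathcal H)$, $s\le t$: $W_{t,t}=I$, $W_{s,r}W_{r,t}=W_{s,t}$ for $s\le r\le t$. The densely defined closed operators $G_t$ have a joint core $\mathcal D$, a linear subspace with $\mathcal D\subseteq\operatorname{dom}G_t^N$ for some $N\ge2$ and $W_{s,t}\mathcal D\subseteq\mathcal D$; on $\mathcal D$ one has $\partial_tW_{s,t}=-W_{s,t}G_t$ and $\partial_sW_{s,t}=G_sW_{s,t}$. (b) There is a positive self-adjoint operator $\Lambda$ such that $\Phi_t(X)[\chi,\psi]=\langle\Lambda^{1/2}\chi,A_t(X)\Lambda^{1/2}\psi\rangle$ for $\chi,\psi\in\operatorname{dom}\Lambda^{1/2}$,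 $X\in\mathcal B(\mathcal H)$, where $A_t=\Lambda^{-1/2}\Phi_t(\cdot)\Lambda^{-1/2}$ is a bounded (uniformly in $t$), normal, completely positive map on $\mathcal B(\mathcal H)$ and $t\mapsto A_t(X)$ is ultraweakly continuous for each $X$; moreover $\Lambda\ge\Phi_t(I)\ge I$ as forms on $\operatorname{dom}\Lambda^{1/2}$. (c) $\mathcal D\subseteq\operatorname{dom}\Lambda^{1/2}\cap\operatorname{dom}G_t^*\cap\operatorname{dom}H_t$, and on $\mathcal D$ one has $G_t^*+G_t=\Phi_t(I)$ and $G_t=\frac12\Phi_t(I)+iH_t$. (d) For $\psi\in\mathcal D$ the vectors $\Lambda^{1/2}W_{s,t}\psi$ are in $L_2$ in $s\in[0,t]$ and norm-continuous in $t\in[s,\infty)$. (e) For some Kraus decomposition $A_t(X)=\sum_kA_k(t)^*XA_k(t)$, with $\Phi_k(t)=A_k(t)\Lambda^{1/2}$: $\mathcal D\subseteq\operatorname{dom}\Lambda^{1/2}\Phi_k(t)$ for all $k,t$, and for $\psi\in\mathcal D$ the vectors $\Lambda^{1/2}\Phi_k(s)W_{s,t}\psi$ are in $L_2$ in $s\in[0,t]$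 and norm-continuous in $t\in[s,\infty)$. Put $V_{\tau,t}(B)=W_{\tau,t}^*BW_{\tau,t}$, $P^{(0)}_{\tau,t}=V_{\tau,t}$, and let $P^{(n+1)}_{\tau,t}(B)$ be the bounded operator with the quadratic form $$\langle\psi,V_{\tau,t}(B)\psi\rangle+\int_\tau^t\Phi_s\bigl(P^{(n)}_{\tau,s}(B)\bigr)[W_{s,t}\psi]\,ds,\qquad\psi\in\mathcal D.$$ The minimal solution of (1.1) is $P^{\min}_{\tau,t}(B)=\operatorname{l.u.b.}_nP^{(n)}_{\tau,t}(B)$ for bounded $B\ge0$. For the unbounded operator $\Phi_s(I)$ let $P^{\min}_{s,t}\Phi_s(I)$ be the form $$\psi\mapsto\sup\{\langle\psi,P^{\min}_{s,t}(X)\psi\rangle:\ 0\le X\in\mathcal B(\mathcal H),\ X\le\Phi_s(I)\text{ on }\mathcal D\}\in[0,\infty],$$ and let $\int_\tau^tP^{\min}_{s,t}\Phi_s(I)\,ds$ be the operator associated with the quadratic form $q[\psi]=\int_\tau^t\bigl(P^{\min}_{s,t}\Phi_s(I)\bigr)[\psi]\,ds$, that is, $\psi$ is in its domain, with value $\varphi$,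 if $q[\psi]<\infty$ and $q(\chi,\psi)=\langle\chi,\varphi\rangle$ for all $\chi$ with $q[\chi]<\infty$. **Theorem.** Let $0\le\tau\le t$. If the domain of the operator $\int_\tau^tP^{\min}_{s,t}\Phi_s(I)\,ds$ is dense in $\mathcal H$, then $P^{\min}_{\tau,t}(I)=I$. In particular, if this holds for all $0\le\tau\le t$, the minimal solution of (1.1) is unital. -/

import Mathlib

open scoped InnerProductSpace

noncomputable section

namespace MarkovMaster

variable {H : Type*} [NormedAddCommGroup H] [InnerProductSpace ℂ H]

/-! ### Unbounded operators -/

/-- The value `T x` of a partially defined operator, as a total function of `x`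
(`0` outside of the domain; every use is accompanied by the domain condition). -/
def app (T : H →ₗ.[ℂ] H) (x : H) : H :=
  open Classical in if hx : x ∈ T.domain then T ⟨x, hx⟩ else 0

/-- The domain of the power `T ^ n` of an unbounded operator. -/
def domPow (T : H →ₗ.[ℂ] H) : ℕ → Set H
  | 0 => Set.univ
  | n + 1 => {x | x ∈ T.domain ∧ app T x ∈ domPow T n}

/-- `S = L ^ (1/2)`: the operator `S` is self-adjoint and positive, and `S ∘ S = L` as unbounded
operators, domains included. For a positive self-adjoint `L` there is exactly one such `S`. -/
structure IsPositiveSqrt [CompleteSpace H] (S L : H →ₗ.[ℂ] H) : Prop where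
  selfAdjoint : IsSelfAdjoint S
  nonneg : ∀ x ∈ S.domain, 0 ≤ (⟪x, app S x⟫_ℂ).re
  mem_domain_iff : ∀ x, x ∈ L.domain ↔ x ∈ S.domain ∧ app S x ∈ S.domain
  app_app : ∀ x ∈ L.domain, app L x = app S (app S x)

/-- The bounded operator `T` with `⟪ψ, T ψ⟫ = q ψ` for all `ψ ∈ D` (unique if `D` is dense);
`0` if there is none. -/
def opOfForm (D : Submodule ℂ H) (q : H → ℂ) : H →L[ℂ] H :=
  open Classical in
  if h : ∃ T : H →L[ℂ] H, ∀ ψ ∈ D, ⟪ψ, T ψ⟫_ℂ = q ψ then h.choose else 0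

/-! ### The operator associated with a positive quadratic form -/

/-- Sesquilinear form (conjugate-linear in `χ`) obtained from a positive quadratic form `q` by
polarization; it is meaningful where `q` is finite. -/
def polar (q : H → ENNReal) (χ ψ : H) : ℂ :=
  (1 / 4 : ℂ) * ∑ k ∈ Finset.range 4, Complex.I ^ k * ((q (ψ + Complex.I ^ k • χ)).toReal : ℂ)

/-- Domain of the operator `C` associated with the positive quadratic form `q`, where `q = ∞`
outside of the form domain: `ψ ∈ dom C` and `C ψ = φ` if and only if `q ψ < ∞` and
`q(χ, ψ) = ⟪χ, φ⟫` for all `χ` in the form domain. -/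
def opDomain (q : H → ENNReal) : Set H :=
  {ψ | q ψ < ⊤ ∧ ∃ φ : H, ∀ χ, q χ < ⊤ → polar q χ ψ = ⟪χ, φ⟫_ℂ}

/-! ### Ultraweak continuity -/

/-- Ultraweak continuity on `[0, ∞)` of an operator-valued function: continuity of all the
functionals `X ↦ ∑ₙ ⟪uₙ, X vₙ⟫` with `∑ ‖uₙ‖² < ∞`, `∑ ‖vₙ‖² < ∞`. -/
def UltraweaklyContinuous (X : ℝ → H →L[ℂ] H) : Prop :=
  ∀ u v : ℕ → H, Summable (fun n => ‖u n‖ ^ 2) → Summable (fun n => ‖v n‖ ^ 2) →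
    ContinuousOn (fun t => ∑' n, ⟪u n, X t (v n)⟫_ℂ) (Set.Ici 0)

/-! ### The Markov master equation -/

/-- The objects entering the Markov master equation
`∂ₜ P_{τ,t}(B) = Φₜ(P_{τ,t}(B)) - Gₜ* P_{τ,t}(B) - P_{τ,t}(B) Gₜ`, `Gₜ = Φₜ(I)/2 + i Hₜ`.
The unbounded completely positive map `Φₜ` is given through the map
`A t = L^{-1/2} Φₜ(·) L^{-1/2}` of bounded operators, that is
`Φₜ(X)[χ, ψ] = ⟪L^{1/2} χ, A t X (L^{1/2} ψ)⟫`. -/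
structure Data (H : Type*) [NormedAddCommGroup H] [InnerProductSpace ℂ H] [CompleteSpace H] where
  /-- the dominating operator `Λ` -/
  L : H →ₗ.[ℂ] H
  /-- its square root `Λ^{1/2}` -/
  sqrtL : H →ₗ.[ℂ] H
  /-- `A t = Λ^{-1/2} Φₜ(·) Λ^{-1/2}` -/
  A : ℝ → CompletelyPositiveMap (H →L[ℂ] H) (H →L[ℂ] H)
  /-- the Hamiltonians `Hₜ` -/
  Ham : ℝ → H →ₗ.[ℂ] H
  /-- the operators `Gₜ` -/
  G : ℝ → H →ₗ.[ℂ] H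
  /-- the evolution system `W_{s,t}`, `0 ≤ s ≤ t` -/
  W : ℝ → ℝ → H →L[ℂ] H
  /-- the joint core -/
  D : Submodule ℂ H
  /-- the exponent for which the core is contained in `dom Gₜ ^ N` -/
  N : ℕ

namespace Data

variable [CompleteSpace H] (M : Data H)

/-- The sesquilinear form `Φₜ(X)[χ, ψ]`, `χ, ψ ∈ dom Λ^{1/2}`. -/
def phi (t : ℝ) (X : H →L[ℂ] H) (χ ψ : H) : ℂ :=
  ⟪app M.sqrtL χ, M.A t X (app M.sqrtL ψ)⟫_ℂ

/-- The sequence `K k t` is a Kraus decomposition of `A t`, `t ≥ 0`: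
`A t X = ∑ₖ (K k t)* X (K k t)`. Then `Φₜ(X) = ∑ₖ Φₖ(t)* X Φₖ(t)` with `Φₖ(t) = K k t Λ^{1/2}`. -/
def IsKraus (K : ℕ → ℝ → H →L[ℂ] H) : Prop :=
  ∀ t, 0 ≤ t → ∀ (X : H →L[ℂ] H) (φ χ : H),
    HasSum (fun k => ⟪K k t φ, X (K k t χ)⟫_ℂ) ⟪φ, M.A t X χ⟫_ℂ

/-- The domain and continuity assumptions on the master equation. -/
structure Assumptions : Prop where
  -- `W` is a strongly continuous contractive evolution system
  W_self : ∀ t, 0 ≤ t → M.W t t = 1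
  W_comp : ∀ s r t, 0 ≤ s → s ≤ r → r ≤ t → M.W s r ∘L M.W r t = M.W s t
  W_contr : ∀ s t, 0 ≤ s → s ≤ t → ‖M.W s t‖ ≤ 1
  W_cont : ∀ ψ : H, ContinuousOn (fun p : ℝ × ℝ => M.W p.1 p.2 ψ) {p | 0 ≤ p.1 ∧ p.1 ≤ p.2}
  -- the generators: densely defined closed operators with the joint core `D ⊆ dom Gₜ ^ N`
  G_dense : ∀ t, 0 ≤ t → Dense ((M.G t).domain : Set H)
  G_closed : ∀ t, 0 ≤ t → (M.G t).IsClosed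
  G_core : ∀ t, 0 ≤ t → (M.G t).HasCore M.D
  two_le_N : 2 ≤ M.N
  D_domPow : ∀ t, 0 ≤ t → (M.D : Set H) ⊆ domPow (M.G t) M.N
  W_mem : ∀ s t, 0 ≤ s → s ≤ t → ∀ ψ ∈ M.D, M.W s t ψ ∈ M.D
  -- `∂ₜ W_{s,t} = - W_{s,t} Gₜ` and `∂ₛ W_{s,t} = Gₛ W_{s,t}` on the core
  W_deriv_right : ∀ s t, 0 ≤ s → s ≤ t → ∀ ψ ∈ M.D,
    HasDerivWithinAt (fun r => M.W s r ψ) (-(M.W s t (app (M.G t) ψ))) (Set.Ici s) t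
  W_deriv_left : ∀ s t, 0 ≤ s → s ≤ t → ∀ ψ ∈ M.D,
    HasDerivWithinAt (fun r => M.W r t ψ) (app (M.G s) (M.W s t ψ)) (Set.Icc 0 t) s
  -- the positive self-adjoint operator `Λ`
  L_selfAdjoint : IsSelfAdjoint M.L
  sqrtL_sqrt : IsPositiveSqrt M.sqrtL M.L
  -- `Λ ≥ Φₜ(I) ≥ I`, in the sense of forms on `dom Λ^{1/2}`
  phi_le : ∀ t, 0 ≤ t → ∀ ψ ∈ M.sqrtL.domain, (M.phi t 1 ψ ψ).re ≤ ‖app M.sqrtL ψ‖ ^ 2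
  le_phi : ∀ t, 0 ≤ t → ∀ ψ ∈ M.sqrtL.domain, ‖ψ‖ ^ 2 ≤ (M.phi t 1 ψ ψ).re
  -- the core lies in the form domain
  D_le : M.D ≤ M.sqrtL.domain
  -- `Gₜ* + Gₜ = Φₜ(I)` on the core
  D_le_adjoint : ∀ t, 0 ≤ t → M.D ≤ (M.G t).adjoint.domain
  adjoint_add : ∀ t, 0 ≤ t → ∀ χ ∈ M.D, ∀ ψ ∈ M.D,
    ⟪χ, app (M.G t).adjoint ψ + app (M.G t) ψ⟫_ℂ = M.phi t 1 χ ψ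
  -- `Gₜ = Φₜ(I) / 2 + i Hₜ` on the core, with a densely defined symmetric `Hₜ`
  Ham_dense : ∀ t, 0 ≤ t → Dense ((M.Ham t).domain : Set H)
  Ham_symm : ∀ t, 0 ≤ t → (M.Ham t).IsFormalAdjoint (M.Ham t)
  D_le_Ham : ∀ t, 0 ≤ t → M.D ≤ (M.Ham t).domain
  G_eq : ∀ t, 0 ≤ t → ∀ χ ∈ M.D, ∀ ψ ∈ M.D,
    ⟪χ, app (M.G t) ψ⟫_ℂ
      = (1 / 2 : ℂ) * M.phi t 1 χ ψ + Complex.I * ⟪χ, app (M.Ham t) ψ⟫_ℂ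
  -- the CP-maps `A t` are bounded, normal and ultraweakly continuous in `t`
  A_bounded : ∃ C : ℝ, ∀ t, 0 ≤ t → ∀ X, ‖M.A t X‖ ≤ C * ‖X‖
  A_normal : ∀ t, 0 ≤ t → ScottContinuous (M.A t)
  A_cont : ∀ X, UltraweaklyContinuous (fun t => M.A t X)
  -- `Λ^{1/2} W_{s,t} ψ` is `L²` in `s` and norm-continuous in `t`
  memLp : ∀ t, 0 ≤ t → ∀ ψ ∈ M.D,
    MeasureTheory.MemLp (fun s => app M.sqrtL (M.W s t ψ)) 2
      (MeasureTheory.volume.restrict (Set.Icc 0 t))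
  norm_cont : ∀ s, 0 ≤ s → ∀ ψ ∈ M.D,
    ContinuousOn (fun t => app M.sqrtL (M.W s t ψ)) (Set.Ici s)
  -- the same for `Λ^{1/2} Φₖ(s) W_{s,t} ψ`, for some Kraus decomposition with
  -- `D ⊆ dom Λ^{1/2} Φₖ(t)`
  kraus : ∃ K : ℕ → ℝ → H →L[ℂ] H, M.IsKraus K ∧ ∀ k,
    (∀ t, 0 ≤ t → ∀ ψ ∈ M.D, K k t (app M.sqrtL ψ) ∈ M.sqrtL.domain) ∧
    (∀ t, 0 ≤ t → ∀ ψ ∈ M.D,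
      MeasureTheory.MemLp (fun s => app M.sqrtL (K k s (app M.sqrtL (M.W s t ψ)))) 2
        (MeasureTheory.volume.restrict (Set.Icc 0 t))) ∧
    (∀ s, 0 ≤ s → ∀ ψ ∈ M.D,
      ContinuousOn (fun t => app M.sqrtL (K k s (app M.sqrtL (M.W s t ψ)))) (Set.Ici s))

/-- `V_{τ,t}(B) = W_{τ,t}* B W_{τ,t}`. -/
def V (τ t : ℝ) (B : H →L[ℂ] H) : H →L[ℂ] H :=
  (M.W τ t).adjoint ∘L B ∘L M.W τ t

/-- The iterations `P⁽⁰⁾_{τ,t}(B) = V_{τ,t}(B)`,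
`P⁽ⁿ⁺¹⁾_{τ,t}(B) = V_{τ,t}(B) + ∫_τ^t V_{s,t} Φₛ P⁽ⁿ⁾_{τ,s}(B) ds`, where the right-hand side is a
quadratic form on the core. -/
def iter : ℕ → ℝ → ℝ → (H →L[ℂ] H) → (H →L[ℂ] H)
  | 0, τ, t, B => M.V τ t B
  | n + 1, τ, t, B => opOfForm M.D fun ψ =>
      ⟪ψ, M.V τ t B ψ⟫_ℂ
        + ∫ s in τ..t, M.phi s (iter n τ s B) (M.W s t ψ) (M.W s t ψ)

/-- The minimal solution `P^min_{τ,t}(B) = l.u.b. P⁽ⁿ⁾_{τ,t}(B)` for bounded positive `B`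
(least upper bound in the order of operators). -/
def pMin (τ t : ℝ) (B : H →L[ℂ] H) : H →L[ℂ] H :=
  open Classical in
  if h : ∃ T, IsLUB (Set.range fun n => M.iter n τ t B) T then h.choose else 0

/-- The bounded positive operators `X ≤ Φₛ(I)`. -/
def minorants (s : ℝ) : Set (H →L[ℂ] H) :=
  {X | 0 ≤ X ∧ ∀ ψ ∈ M.D, (⟪ψ, X ψ⟫_ℂ).re ≤ (M.phi s 1 ψ ψ).re}

/-- The quadratic form, with values in `[0, ∞]`, of `P^min_{s,t} Φₛ(I)`: the value of the normal
positive map `P^min_{s,t}` at the unbounded positive operator `Φₛ(I)` is the supremum of its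
values at the bounded positive operators below `Φₛ(I)`. -/
def pMinPhi (s t : ℝ) (ψ : H) : ENNReal :=
  ⨆ X ∈ M.minorants s, ENNReal.ofReal (⟪ψ, M.pMin s t X ψ⟫_ℂ).re

/-- The quadratic form of `∫_τ^t P^min_{s,t} Φₛ(I) ds`. -/
def intForm (τ t : ℝ) (ψ : H) : ENNReal :=
  ∫⁻ s in Set.Icc τ t, M.pMinPhi s t ψ

end Data

end MarkovMaster

end

/-!
Telescoping over the iterations, with `‖ψ‖² - ‖W_{s,t} ψ‖² = ∫_s^t Φ_r(I)[W_{r,t} ψ] dr` as the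
first step, identifies the sum of the defects `I - P⁽ᵏ⁾_{τ,t}(I)`, `k ≤ n`, with
`∫_τ^t P⁽ⁿ⁾_{s,t} Φ_s(I) ds`, which lies below `∫_τ^t P^min_{s,t} Φ_s(I) ds` in the sense of forms.
Each defect dominates `I - P^min_{τ,t}(I)`, so every multiple of the form of `I - P^min_{τ,t}(I)`
stays below that one form, and `I - P^min_{τ,t}(I)` vanishes wherever the latter is finite.

The identity is an induction on `n` by Tonelli's theorem on the triangle `τ ≤ s ≤ r ≤ t`; the Kraus
decomposition turns `Φ_r` into a sum of positive forms, so that it commutes with integrals and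
increasing limits. Integration in `s` requires bounded minorants of `Φ_s(I)` depending measurably
on `s`: the Moreau regularizations `inf_χ (Φ_s(I)[χ] + m ‖ψ - χ‖²)`, which are infima of continuous
functions of `s` and increase to `Φ_s(I)` with `m`.
-/

noncomputable section

open scoped InnerProductSpace ENNReal ComplexOrder
open MeasureTheory Filter Topology

namespace MarkovMaster

variable {H : Type*} [NormedAddCommGroup H] [InnerProductSpace ℂ H]

/-! ### Quadratic forms of bounded operators -/

/-- The real quadratic form `ψ ↦ Re ⟪ψ, X ψ⟫` of a bounded operator. A self-adjoint `X` is
determined by it, and order and limits of such operators are those of their forms. -/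
def quadForm (X : H →L[ℂ] H) (ψ : H) : ℝ := (⟪ψ, X ψ⟫_ℂ).re

lemma quadForm_zero (ψ : H) : quadForm (0 : H →L[ℂ] H) ψ = 0 := by simp [quadForm]

lemma quadForm_one (ψ : H) : quadForm (1 : H →L[ℂ] H) ψ = ‖ψ‖ ^ 2 :=
  inner_self_eq_norm_sq (𝕜 := ℂ) ψ

lemma quadForm_add (X Y : H →L[ℂ] H) (ψ : H) :
    quadForm (X + Y) ψ = quadForm X ψ + quadForm Y ψ := by
  simp [quadForm]

lemma quadForm_sub (X Y : H →L[ℂ] H) (ψ : H) :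
    quadForm (X - Y) ψ = quadForm X ψ - quadForm Y ψ := by
  simp [quadForm]

lemma quadForm_smul (c : ℝ) (X : H →L[ℂ] H) (ψ : H) :
    quadForm (c • X) ψ = c * quadForm X ψ := by
  simp only [quadForm, smul_apply]
  rw [← Complex.coe_smul, inner_smul_right, Complex.re_ofReal_mul]

lemma quadForm_sum {ι : Type*} (s : Finset ι) (X : ι → H →L[ℂ] H) (ψ : H) :
    quadForm (∑ i ∈ s, X i) ψ = ∑ i ∈ s, quadForm (X i) ψ :=
  map_sum (AddMonoidHom.mk' (quadForm · ψ) (quadForm_add · · ψ)) X s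

lemma continuous_quadForm (X : H →L[ℂ] H) : Continuous (quadForm X) := by
  unfold quadForm
  fun_prop

lemma quadForm_add_add_quadForm_sub (X : H →L[ℂ] H) (ψ φ : H) :
    quadForm X (ψ + φ) + quadForm X (ψ - φ) = 2 * quadForm X ψ + 2 * quadForm X φ := by
  simp only [quadForm, map_add, map_sub, inner_add_left, inner_add_right, inner_sub_left,
    inner_sub_right, Complex.add_re, Complex.sub_re]
  ring

lemma quadForm_le_norm_mul (X : H →L[ℂ] H) (ψ : H) : quadForm X ψ ≤ ‖X‖ * ‖ψ‖ ^ 2 := by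
  calc quadForm X ψ ≤ ‖⟪ψ, X ψ⟫_ℂ‖ := Complex.re_le_norm _
    _ ≤ ‖ψ‖ * ‖X ψ‖ := norm_inner_le_norm _ _
    _ ≤ ‖ψ‖ * (‖X‖ * ‖ψ‖) := by gcongr; exact X.le_opNorm _
    _ = ‖X‖ * ‖ψ‖ ^ 2 := by ring

lemma abs_quadForm_sub_quadForm_le (X : H →L[ℂ] H) (ψ φ : H) :
    |quadForm X ψ - quadForm X φ| ≤ ‖X‖ * (‖ψ‖ + ‖φ‖) * ‖ψ - φ‖ := by
  have h : quadForm X ψ - quadForm X φ = (⟪ψ, X (ψ - φ)⟫_ℂ + ⟪ψ - φ, X φ⟫_ℂ).re := by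
    simp [quadForm]
  rw [h]
  calc |(⟪ψ, X (ψ - φ)⟫_ℂ + ⟪ψ - φ, X φ⟫_ℂ).re|
      ≤ ‖⟪ψ, X (ψ - φ)⟫_ℂ + ⟪ψ - φ, X φ⟫_ℂ‖ := Complex.abs_re_le_norm _
    _ ≤ ‖ψ‖ * ‖X (ψ - φ)‖ + ‖ψ - φ‖ * ‖X φ‖ :=
        (norm_add_le _ _).trans (add_le_add (norm_inner_le_norm _ _) (norm_inner_le_norm _ _))
    _ ≤ ‖ψ‖ * (‖X‖ * ‖ψ - φ‖) + ‖ψ - φ‖ * (‖X‖ * ‖φ‖) := by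
        gcongr <;> exact X.le_opNorm _
    _ = ‖X‖ * (‖ψ‖ + ‖φ‖) * ‖ψ - φ‖ := by ring

lemma measurable_quadForm_comp {α : Type*} [MeasurableSpace α] {Y : α → H →L[ℂ] H}
    (hY : ∀ χ, Measurable fun a => quadForm (Y a) χ) {v : α → H} (hv : StronglyMeasurable v) :
    Measurable fun a => quadForm (Y a) (v a) := by
  refine measurable_of_tendsto_metrizable (f := fun n a => quadForm (Y a) (hv.approx n a))
    (fun n => (hv.approx n).measurable_bind (fun χ a => quadForm (Y a) χ) hY) ?_
  exact tendsto_pi_nhds.2 fun a =>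
    ((continuous_quadForm (Y a)).tendsto (v a)).comp (hv.tendsto_approx a)

lemma quadForm_nonneg {X : H →L[ℂ] H} (hX : 0 ≤ X) (ψ : H) : 0 ≤ quadForm X ψ :=
  ((ContinuousLinearMap.nonneg_iff_isPositive X).1 hX).re_inner_nonneg_right ψ

lemma quadForm_mono {X Y : H →L[ℂ] H} (h : X ≤ Y) (ψ : H) : quadForm X ψ ≤ quadForm Y ψ := by
  have := ((ContinuousLinearMap.le_def X Y).1 h).re_inner_nonneg_right ψ
  rwa [← sub_nonneg, ← quadForm_sub]

lemma nonneg_of_forall_mem_dense {D : Set H} (hD : Dense D) {X : H →L[ℂ] H}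
    (h : ∀ ψ ∈ D, 0 ≤ ⟪ψ, X ψ⟫_ℂ) : 0 ≤ X := by
  have hall : ∀ ψ, 0 ≤ ⟪ψ, X ψ⟫_ℂ := fun ψ =>
    have hcl : IsClosed {ψ : H | 0 ≤ ⟪ψ, X ψ⟫_ℂ} := isClosed_le continuous_const (by fun_prop)
    hcl.closure_subset_iff.2 h (hD ψ)
  rw [ContinuousLinearMap.nonneg_iff_isPositive, ContinuousLinearMap.isPositive_iff_complex]
  intro ψ
  rw [← inner_conj_symm (X ψ) ψ, Complex.conj_eq_iff_im.2 (Complex.le_def.1 (hall ψ)).2.symm]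
  exact ⟨(Complex.eq_re_of_ofReal_le (hall ψ)).symm, (Complex.le_def.1 (hall ψ)).1⟩

section Order

variable [CompleteSpace H]

lemma inner_eq_quadForm {X : H →L[ℂ] H} (hX : IsSelfAdjoint X) (ψ : H) :
    ⟪ψ, X ψ⟫_ℂ = (quadForm X ψ : ℂ) := by
  refine (Complex.conj_eq_iff_re.1 ?_).symm
  rw [inner_conj_symm]
  exact hX.isSymmetric ψ ψ

lemma le_of_forall_mem_dense {D : Set H} (hD : Dense D) {X Y : H →L[ℂ] H} (hX : IsSelfAdjoint X)
    (hY : IsSelfAdjoint Y) (h : ∀ ψ ∈ D, quadForm X ψ ≤ quadForm Y ψ) : X ≤ Y := by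
  refine sub_nonneg.1 (nonneg_of_forall_mem_dense hD fun ψ hψ => ?_)
  rw [inner_eq_quadForm (hY.sub hX), quadForm_sub]
  exact_mod_cast sub_nonneg.2 (h ψ hψ)

lemma norm_le_of_quadForm_le {X : H →L[ℂ] H} (hX : 0 ≤ X) {c : ℝ} (hc : 0 ≤ c)
    (h : ∀ ψ, quadForm X ψ ≤ c * ‖ψ‖ ^ 2) : ‖X‖ ≤ c := by
  rw [CStarAlgebra.norm_le_iff_le_algebraMap X hc hX]
  refine le_of_forall_mem_dense dense_univ hX.isSelfAdjoint (.algebraMap _ (.all c)) fun ψ _ => ?_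
  rw [Algebra.algebraMap_eq_smul_one, quadForm_smul, quadForm_one]
  exact h ψ

lemma norm_one_sub_le {X : H →L[ℂ] H} (hX : 0 ≤ X) (hX1 : X ≤ 1) : ‖1 - X‖ ≤ 1 :=
  (CStarAlgebra.norm_le_norm_of_nonneg_of_le (sub_nonneg.2 hX1) (sub_le_self 1 hX)).trans
    ContinuousLinearMap.norm_id_le

/-- Cauchy–Schwarz for the semi-inner product `⟪·, X ·⟫`, in the form `‖b* b ψ‖ ≤ ‖b*‖ ‖b ψ‖`. -/
lemma norm_apply_sq_le {X : H →L[ℂ] H} (hX : 0 ≤ X) (ψ : H) :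
    ‖X ψ‖ ^ 2 ≤ ‖X‖ * quadForm X ψ := by
  obtain ⟨b, rfl⟩ := CStarAlgebra.nonneg_iff_eq_star_mul_self.1 hX
  have hq : quadForm (star b * b) ψ = ‖b ψ‖ ^ 2 := by
    rw [quadForm, ContinuousLinearMap.star_eq_adjoint, mul_apply_eq_comp,
      ContinuousLinearMap.adjoint_inner_right]
    exact inner_self_eq_norm_sq (𝕜 := ℂ) _
  calc ‖(star b * b) ψ‖ ^ 2 ≤ (‖star b‖ * ‖b ψ‖) ^ 2 := by
        gcongr
        exact (star b).le_opNorm _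
    _ = ‖star b * b‖ * quadForm (star b * b) ψ := by
        rw [hq, CStarRing.norm_star_mul_self, norm_star]
        ring

lemma cauchySeq_apply_of_monotone {X : ℕ → H →L[ℂ] H} (hX : Monotone X) {c : ℝ}
    (hc : ∀ n, ‖X n‖ ≤ c) (ψ : H) : CauchySeq fun n => X n ψ := by
  have hq : CauchySeq fun n => quadForm (X n) ψ :=
    (tendsto_atTop_ciSup (fun m n hmn => quadForm_mono (hX hmn) ψ)
      ⟨c * ‖ψ‖ ^ 2, Set.forall_mem_range.2 fun n => (quadForm_le_norm_mul _ ψ).trans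
        (by gcongr; exact hc n)⟩).cauchySeq
  have hdist : ∀ m n, m ≤ n →
      dist (X n ψ) (X m ψ) ^ 2 ≤ (c + c) * dist (quadForm (X n) ψ) (quadForm (X m) ψ) := by
    intro m n hmn
    calc dist (X n ψ) (X m ψ) ^ 2 = ‖(X n - X m) ψ‖ ^ 2 := by rw [dist_eq_norm, sub_apply]
      _ ≤ ‖X n - X m‖ * quadForm (X n - X m) ψ := norm_apply_sq_le (sub_nonneg.2 (hX hmn)) ψ
      _ ≤ (c + c) * dist (quadForm (X n) ψ) (quadForm (X m) ψ) := by
        rw [quadForm_sub, Real.dist_eq]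
        exact mul_le_mul ((norm_sub_le _ _).trans (add_le_add (hc n) (hc m))) (le_abs_self _)
          (sub_nonneg.2 (quadForm_mono (hX hmn) ψ))
          (by linarith [(norm_nonneg _).trans (hc 0)])
  have hc0 : 0 ≤ c := (norm_nonneg _).trans (hc 0)
  rw [Metric.cauchySeq_iff'] at hq ⊢
  intro ε hε
  obtain ⟨N, hN⟩ := hq (ε ^ 2 / (c + c + 1)) (by positivity)
  refine ⟨N, fun n hn => lt_of_pow_lt_pow_left₀ 2 hε.le ((hdist N n hn).trans_lt ?_)⟩
  have h := hN n hn
  rw [lt_div_iff₀ (by positivity)] at h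
  nlinarith [dist_nonneg (x := quadForm (X n) ψ) (y := quadForm (X N) ψ)]

/-- The supremum is the strong limit. -/
lemma exists_isLUB_of_monotone {X : ℕ → H →L[ℂ] H} (hX : Monotone X) {c : ℝ}
    (hc : ∀ n, ‖X n‖ ≤ c) : ∃ T, IsLUB (Set.range X) T := by
  choose f hf using fun ψ => cauchySeq_tendsto_of_complete (cauchySeq_apply_of_monotone hX hc ψ)
  let T : H →L[ℂ] H := continuousLinearMapOfTendsto X (tendsto_pi_nhds.2 hf)
  have hlim : ∀ ψ, Tendsto (fun n => ⟪ψ, X n ψ⟫_ℂ) atTop (𝓝 ⟪ψ, T ψ⟫_ℂ) := fun ψ =>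
    tendsto_const_nhds.inner (hf ψ)
  have hpos : ∀ {Y : H →L[ℂ] H}, 0 ≤ Y → ∀ ψ, 0 ≤ ⟪ψ, Y ψ⟫_ℂ := fun hY ψ =>
    ((ContinuousLinearMap.nonneg_iff_isPositive _).1 hY).inner_nonneg_right ψ
  refine ⟨T, Set.forall_mem_range.2 fun m => ?_, fun U hU => ?_⟩
  · refine sub_nonneg.1 (nonneg_of_forall_mem_dense dense_univ fun ψ _ => ?_)
    rw [sub_apply, inner_sub_right]
    refine ge_of_tendsto ((hlim ψ).sub_const _) ((eventually_ge_atTop m).mono fun n hn => ?_)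
    simpa only [sub_apply, inner_sub_right] using hpos (sub_nonneg.2 (hX hn)) ψ
  · refine sub_nonneg.1 (nonneg_of_forall_mem_dense dense_univ fun ψ _ => ?_)
    rw [sub_apply, inner_sub_right]
    refine ge_of_tendsto' ((hlim ψ).const_sub _) fun n => ?_
    simpa only [sub_apply, inner_sub_right] using hpos (sub_nonneg.2 (hU ⟨n, rfl⟩)) ψ

end Order

/-! ### Operators from positive sesquilinear forms -/

lemma opOfForm_apply {D : Submodule ℂ H} {q : H → ℂ}
    (h : ∃ T : H →L[ℂ] H, ∀ ψ ∈ D, ⟪ψ, T ψ⟫_ℂ = q ψ) {ψ : H} (hψ : ψ ∈ D) :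
    ⟪ψ, opOfForm D q ψ⟫_ℂ = q ψ := by
  unfold opOfForm
  rw [dif_pos h]
  exact h.choose_spec ψ hψ

section Core

variable {V : Type*} [AddCommGroup V] [Module ℂ V]

/-- The operator is `J* J`, where `J` maps `e x` to the class of `x` in the Hilbert space
completion of the semi-inner product space `V`. -/
lemma exists_op_of_core [CompleteSpace H] (c : PreInnerProductSpace.Core ℂ V) {e : V →ₗ[ℂ] H}
    (he : DenseRange e) {C : ℝ} (hC : ∀ x, (c.inner x x).re ≤ C * ‖e x‖ ^ 2) :
    ∃ T : H →L[ℂ] H, ∀ x, ⟪e x, T (e x)⟫_ℂ = c.inner x x := by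
  let : SeminormedAddCommGroup V :=
    InnerProductSpace.Core.toSeminormedAddCommGroup (c := c)
  let : InnerProductSpace ℂ V := .ofCore c
  let J₀ : V →ₗ[ℂ] UniformSpace.Completion V := UniformSpace.Completion.toComplL.toLinearMap
  have hbound : ∀ x, ‖J₀ x‖ ≤ √C * ‖e x‖ := fun x => by
    calc ‖J₀ x‖ = √(c.inner x x).re := UniformSpace.Completion.norm_coe x
      _ ≤ √(C * ‖e x‖ ^ 2) := Real.sqrt_le_sqrt (hC x)
      _ = √C * ‖e x‖ := by rw [Real.sqrt_mul' _ (sq_nonneg _), Real.sqrt_sq (norm_nonneg _)]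
  let J : H →L[ℂ] UniformSpace.Completion V := J₀.extendOfNorm e
  have hJ : ∀ x, J (e x) = J₀ x := LinearMap.extendOfNorm_eq he ⟨_, hbound⟩
  refine ⟨J.adjoint ∘L J, fun x => ?_⟩
  rw [ContinuousLinearMap.comp_apply, ContinuousLinearMap.adjoint_inner_right, hJ]
  exact UniformSpace.Completion.inner_coe x x

/-- The semi-inner product `⟪u x, B (u y)⟫`, for a positive operator `B`. -/
abbrev formCore {B : H →L[ℂ] H} (hB : B.IsPositive) (u : V →ₗ[ℂ] H) :
    PreInnerProductSpace.Core ℂ V where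
  inner x y := ⟪u x, B (u y)⟫_ℂ
  conj_inner_symm x y := by rw [inner_conj_symm, hB.inner_left_eq_inner_right]
  re_inner_nonneg x := hB.re_inner_nonneg_right (u x)
  add_left x y z := by rw [map_add, inner_add_left]
  smul_left x y a := by rw [map_smul, inner_smul_left]

variable {α : Type*} [MeasurableSpace α] {μ : Measure α} {c : α → PreInnerProductSpace.Core ℂ V}

lemma integrable_core_inner (hc : ∀ x, Integrable (fun a => (c a).inner x x) μ) (x y : V) :
    Integrable (fun a => (c a).inner x y) μ := by
  have hpolar : ∀ a, (c a).inner x y = ((c a).inner (x + y) (x + y)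
      - (c a).inner (x - y) (x - y) + ((c a).inner (x - Complex.I • y) (x - Complex.I • y)
      - (c a).inner (x + Complex.I • y) (x + Complex.I • y)) * Complex.I) / 4 := fun a => by
    let : SeminormedAddCommGroup V :=
      InnerProductSpace.Core.toSeminormedAddCommGroup (c := c a)
    let : InnerProductSpace ℂ V := .ofCore (c a)
    have h := inner_eq_sum_norm_sq_div_four (𝕜 := ℂ) x y
    simp only [← inner_self_eq_norm_sq_to_K] at h
    exact h
  simp only [hpolar]
  exact (((hc _).sub (hc _)).add (((hc _).sub (hc _)).mul_const _)).div_const 4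

/-- The integral of a measurable family of semi-inner products. -/
abbrev integralCore (hc : ∀ x, Integrable (fun a => (c a).inner x x) μ) :
    PreInnerProductSpace.Core ℂ V where
  inner x y := ∫ a, (c a).inner x y ∂μ
  conj_inner_symm x y := by
    rw [← integral_conj]
    exact integral_congr_ae (.of_forall fun a => (c a).conj_inner_symm x y)
  re_inner_nonneg x := by
    rw [← integral_re (hc x)]
    exact integral_nonneg fun a => (c a).re_inner_nonneg x
  add_left x y z := by
    rw [← integral_add (integrable_core_inner hc x z) (integrable_core_inner hc y z)]
    exact integral_congr_ae (.of_forall fun a => (c a).add_left x y z)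
  smul_left x y r := by
    rw [← integral_const_mul]
    exact integral_congr_ae (.of_forall fun a => (c a).smul_left x y r)

lemma exists_op_integral [CompleteSpace H] {e : V →ₗ[ℂ] H} (he : DenseRange e)
    {B : α → H →L[ℂ] H} (hB : ∀ a, 0 ≤ B a) (u : α → V →ₗ[ℂ] H)
    (hint : ∀ x, Integrable (fun a => ⟪u a x, B a (u a x)⟫_ℂ) μ) {C : ℝ}
    (hC : ∀ x, (∫ a, ⟪u a x, B a (u a x)⟫_ℂ ∂μ).re ≤ C * ‖e x‖ ^ 2) :
    ∃ T : H →L[ℂ] H, ∀ x, ⟪e x, T (e x)⟫_ℂ = ∫ a, ⟪u a x, B a (u a x)⟫_ℂ ∂μ :=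
  exists_op_of_core (integralCore (c := fun a =>
    formCore ((ContinuousLinearMap.nonneg_iff_isPositive _).1 (hB a)) (u a)) hint) he hC

end Core

/-! ### Unbounded self-adjoint operators -/

lemma app_of_mem {T : H →ₗ.[ℂ] H} {x : H} (hx : x ∈ T.domain) : app T x = T ⟨x, hx⟩ := by
  simp [app, hx]

lemma dense_of_hasCore {T : H →ₗ.[ℂ] H} {D : Submodule ℂ H} (hd : Dense (T.domain : Set H))
    (hcl : T.IsClosed) (hD : T.HasCore D) : Dense (D : Set H) := by
  have hclos : (T.domRestrict D).IsClosable := hcl.isClosable.leIsClosable T.domRestrict_le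
  have hg := hclos.graph_closure_eq_closure_graph
  rw [hD.closure_eq] at hg
  have hsub : (T.domain : Set H) ⊆ closure D := fun x hx => by
    have hmem : (x, T ⟨x, hx⟩) ∈ closure ((T.domRestrict D).graph : Set (H × H)) := by
      rw [← Submodule.topologicalClosure_coe, hg]
      exact T.mem_graph ⟨x, hx⟩
    refine map_mem_closure continuous_fst hmem fun p hp => ?_
    obtain ⟨y, hy, -⟩ := (LinearPMap.mem_graph_iff _).1 hp
    exact hy ▸ (LinearPMap.domRestrict_domain T ▸ y.2 : (y : H) ∈ D ⊓ T.domain).1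
  exact dense_iff_closure_eq.2 (Set.eq_univ_of_univ_subset
    (hd.closure_eq ▸ closure_minimal hsub isClosed_closure))

lemma denseRange_of_isSelfAdjoint [CompleteSpace H] {S : H →ₗ.[ℂ] H} (hS : IsSelfAdjoint S)
    (hinj : ∀ x ∈ S.domain, app S x = 0 → x = 0) : DenseRange S.toFun := by
  have hd := hS.dense_domain
  have hadj : S.adjoint = S := LinearPMap.isSelfAdjoint_def.1 hS
  suffices h : (LinearMap.range S.toFun)ᗮ = ⊥ from
    (Submodule.dense_iff_topologicalClosure_eq_top (s := LinearMap.range S.toFun)).2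
      (Submodule.topologicalClosure_eq_top_iff.2 h)
  refine (Submodule.eq_bot_iff _).2 fun y hy => ?_
  have horth : ∀ x : S.domain, ⟪(0 : H), x⟫_ℂ = ⟪y, S x⟫_ℂ := fun x => by
    rw [inner_zero_left]
    exact ((Submodule.mem_orthogonal' _ y).1 hy _ ⟨x, rfl⟩).symm
  have hyd : y ∈ S.adjoint.domain := LinearPMap.mem_adjoint_domain_of_exists y ⟨0, horth⟩
  have h0 := LinearPMap.adjoint_apply_eq hd ⟨y, hyd⟩ horth
  rw [← app_of_mem hyd, hadj] at h0
  exact hinj y (hadj ▸ hyd) h0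

lemma exists_continuousLinearMap_leftInverse [CompleteSpace H] {S : H →ₗ.[ℂ] H}
    (hS : IsSelfAdjoint S) {C : ℝ} (hb : ∀ x ∈ S.domain, ‖x‖ ≤ C * ‖app S x‖) :
    ∃ g : H →L[ℂ] H, ∀ x ∈ S.domain, g (app S x) = x := by
  have hdense := denseRange_of_isSelfAdjoint hS fun x hx h => by simpa [h] using hb x hx
  have hbound : ∀ x : S.domain, ‖S.domain.subtype x‖ ≤ C * ‖S.toFun x‖ := fun x => by
    have h := hb x x.2
    rwa [app_of_mem x.2] at h
  refine ⟨S.domain.subtype.extendOfNorm S.toFun, fun x hx => ?_⟩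
  rw [app_of_mem hx]
  exact LinearMap.extendOfNorm_eq hdense ⟨C, hbound⟩ ⟨x, hx⟩

/-! ### The flux of an operator along the evolution system -/

namespace Data

variable [CompleteSpace H]

/-- The density `Φ_r(Y)[W_{r,t} ψ]` in `r` of the quadratic form of `∫ V_{r,t} Φ_r(Y_r) dr`. -/
def flux (M : Data H) (t : ℝ) (ψ : H) (r : ℝ) (Y : H →L[ℂ] H) : ℝ :=
  (M.phi r Y (M.W r t ψ) (M.W r t ψ)).re

variable {M : Data H}

lemma flux_eq_quadForm (t : ℝ) (ψ : H) (r : ℝ) (Y : H →L[ℂ] H) :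
    M.flux t ψ r Y = quadForm (M.A r Y) (app M.sqrtL (M.W r t ψ)) := rfl

lemma A_nonneg (r : ℝ) {X : H →L[ℂ] H} (h : 0 ≤ X) : 0 ≤ M.A r X := by
  simpa only [map_zero] using OrderHomClass.mono (M.A r) h

lemma flux_nonneg (t : ℝ) (ψ : H) (r : ℝ) {Y : H →L[ℂ] H} (h : 0 ≤ Y) : 0 ≤ M.flux t ψ r Y :=
  quadForm_nonneg (A_nonneg r h) _

lemma flux_mono (t : ℝ) (ψ : H) (r : ℝ) {X Y : H →L[ℂ] H} (h : X ≤ Y) :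
    M.flux t ψ r X ≤ M.flux t ψ r Y :=
  quadForm_mono (OrderHomClass.mono (M.A r) h) _

lemma flux_sub (t : ℝ) (ψ : H) (r : ℝ) (X Y : H →L[ℂ] H) :
    M.flux t ψ r (X - Y) = M.flux t ψ r X - M.flux t ψ r Y := by
  simp only [flux_eq_quadForm, map_sub, quadForm_sub]

lemma flux_sum (t : ℝ) (ψ : H) (r : ℝ) {ι : Type*} (s : Finset ι) (X : ι → H →L[ℂ] H) :
    M.flux t ψ r (∑ i ∈ s, X i) = ∑ i ∈ s, M.flux t ψ r (X i) := by
  simp only [flux_eq_quadForm, map_sum, quadForm_sum]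

lemma phi_eq_flux (t : ℝ) (ψ : H) (r : ℝ) {Y : H →L[ℂ] H} (h : 0 ≤ Y) :
    M.phi r Y (M.W r t ψ) (M.W r t ψ) = (M.flux t ψ r Y : ℂ) :=
  inner_eq_quadForm (A_nonneg r h).isSelfAdjoint _

lemma flux_le_norm_mul (t : ℝ) (ψ : H) (r : ℝ) {Y : H →L[ℂ] H} (h : 0 ≤ Y) :
    M.flux t ψ r Y ≤ ‖Y‖ * M.flux t ψ r 1 := by
  have hY : Y ≤ ‖Y‖ • (1 : H →L[ℂ] H) := by
    rw [← Algebra.algebraMap_eq_smul_one]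
    exact h.isSelfAdjoint.le_algebraMap_norm_self
  refine (flux_mono t ψ r hY).trans_eq ?_
  rw [flux_eq_quadForm, ← Complex.coe_smul, map_smul, Complex.coe_smul, quadForm_smul,
    flux_eq_quadForm]

variable (M) in
/-- The vectors `v k r = Φₖ(r) W_{r,t} ψ` of a Kraus decomposition, for which
`Φ_r(Y)[W_{r,t} ψ] = ∑ₖ ⟪v k r, Y (v k r)⟫`. Being strongly measurable, they transfer measurability
and monotone limits from the operators `Y` to the flux. -/
structure IsKrausFamily (t : ℝ) (ψ : H) (v : ℕ → ℝ → H) : Prop where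
  stronglyMeasurable : ∀ k, StronglyMeasurable (v k)
  ofReal_flux : ∀ᵐ r ∂volume.restrict (Set.Icc 0 t), ∀ Y : H →L[ℂ] H, 0 ≤ Y →
    ENNReal.ofReal (M.flux t ψ r Y) = ∑' k, ENNReal.ofReal (quadForm Y (v k r))

namespace Assumptions

variable (hM : M.Assumptions)
include hM

lemma dense_D : Dense (M.D : Set H) :=
  dense_of_hasCore (hM.G_dense 0 le_rfl) (hM.G_closed 0 le_rfl) (hM.G_core 0 le_rfl)

lemma norm_le_norm_app {x : H} (hx : x ∈ M.sqrtL.domain) : ‖x‖ ≤ ‖app M.sqrtL x‖ :=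
  le_of_sq_le_sq ((hM.le_phi 0 le_rfl x hx).trans (hM.phi_le 0 le_rfl x hx)) (norm_nonneg _)

lemma W_mem_sqrtL_domain {r t : ℝ} (hr : 0 ≤ r) (hrt : r ≤ t) {ψ : H} (hψ : ψ ∈ M.D) :
    M.W r t ψ ∈ M.sqrtL.domain :=
  hM.D_le (hM.W_mem r t hr hrt ψ hψ)

lemma exists_linearMap_app : ∃ S : M.D →ₗ[ℂ] H, ∀ χ : M.D, S χ = app M.sqrtL χ :=
  ⟨M.sqrtL.toFun ∘ₗ Submodule.inclusion hM.D_le, fun χ => (app_of_mem (hM.D_le χ.2)).symm⟩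

lemma W_apply_W_apply {s r t : ℝ} (hs : 0 ≤ s) (hsr : s ≤ r) (hrt : r ≤ t) (ψ : H) :
    M.W s r (M.W r t ψ) = M.W s t ψ := by
  rw [← hM.W_comp s r t hs hsr hrt, ContinuousLinearMap.comp_apply]

lemma norm_W_apply_le {s t : ℝ} (hs : 0 ≤ s) (hst : s ≤ t) (ψ : H) : ‖M.W s t ψ‖ ≤ ‖ψ‖ := by
  simpa only [one_mul] using (M.W s t).le_of_opNorm_le (hM.W_contr s t hs hst) ψ

lemma exists_isKrausFamily {t : ℝ} (ht : 0 ≤ t) {ψ : H} (hψ : ψ ∈ M.D) :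
    ∃ v, M.IsKrausFamily t ψ v := by
  obtain ⟨K, hK, hK'⟩ := hM.kraus
  obtain ⟨g, hg⟩ := exists_continuousLinearMap_leftInverse hM.sqrtL_sqrt.selfAdjoint (C := 1)
    fun x hx => (one_mul ‖app M.sqrtL x‖).symm ▸ hM.norm_le_norm_app hx
  -- `Λ^{1/2} Φₖ(r) W_{r,t} ψ` is measurable in `r`, hence so is its image under `g = Λ^{-1/2}`
  have hmeas : ∀ k, AEStronglyMeasurable
      (fun s => g (app M.sqrtL (K k s (app M.sqrtL (M.W s t ψ)))))
      (volume.restrict (Set.Icc 0 t)) := fun k =>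
    g.continuous.comp_aestronglyMeasurable ((hK' k).2.1 t ht ψ hψ).aestronglyMeasurable
  refine ⟨fun k => (hmeas k).mk _, fun k => (hmeas k).stronglyMeasurable_mk, ?_⟩
  filter_upwards [ae_restrict_mem measurableSet_Icc, ae_all_iff.2 fun k => (hmeas k).ae_eq_mk]
    with r hr hae Y hY
  have hv : ∀ k, (hmeas k).mk _ r = K k r (app M.sqrtL (M.W r t ψ)) := fun k => by
    rw [← hae k]
    exact hg _ ((hK' k).1 r hr.1 _ (hM.W_mem r t hr.1 hr.2 ψ hψ))
  have hsum : HasSum (fun k => quadForm Y (K k r (app M.sqrtL (M.W r t ψ)))) (M.flux t ψ r Y) :=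
    Complex.hasSum_re (hK r hr.1 Y _ _)
  simp only [hv]
  rw [← hsum.tsum_eq, ENNReal.ofReal_tsum_of_nonneg (fun k => quadForm_nonneg hY _) hsum.summable]

lemma aemeasurable_flux {t : ℝ} (ht : 0 ≤ t) {ψ : H} (hψ : ψ ∈ M.D) {Y : ℝ → H →L[ℂ] H}
    (hY : ∀ r, 0 ≤ Y r) (hYm : ∀ χ, Measurable fun r => quadForm (Y r) χ) :
    AEMeasurable (fun r => M.flux t ψ r (Y r)) (volume.restrict (Set.Icc 0 t)) := by
  obtain ⟨v, hv⟩ := hM.exists_isKrausFamily ht hψ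
  have hm : Measurable fun r => (∑' k, ENNReal.ofReal (quadForm (Y r) (v k r))).toReal :=
    (Measurable.tsum fun k =>
      (measurable_quadForm_comp hYm (hv.stronglyMeasurable k)).ennreal_ofReal).ennreal_toReal
  refine hm.aemeasurable.congr ?_
  filter_upwards [hv.ofReal_flux] with r hr
  rw [← hr _ (hY r), ENNReal.toReal_ofReal (flux_nonneg _ _ _ (hY r))]

lemma integrableOn_flux {t : ℝ} (ht : 0 ≤ t) {ψ : H} (hψ : ψ ∈ M.D) {Y : ℝ → H →L[ℂ] H}
    (hY : ∀ r, 0 ≤ Y r) (hYm : ∀ χ, Measurable fun r => quadForm (Y r) χ) {c : ℝ}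
    (hYc : ∀ r, ‖Y r‖ ≤ c) : IntegrableOn (fun r => M.flux t ψ r (Y r)) (Set.Icc 0 t) := by
  refine ((hM.memLp t ht ψ hψ).integrable_norm_pow two_ne_zero |>.const_mul c).mono'
    (hM.aemeasurable_flux ht hψ hY hYm).aestronglyMeasurable ?_
  filter_upwards [ae_restrict_mem measurableSet_Icc] with r hr
  rw [Real.norm_of_nonneg (flux_nonneg _ _ _ (hY r))]
  calc M.flux t ψ r (Y r) ≤ ‖Y r‖ * M.flux t ψ r 1 := flux_le_norm_mul t ψ r (hY r)
    _ ≤ c * ‖app M.sqrtL (M.W r t ψ)‖ ^ 2 :=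
      mul_le_mul (hYc r) (hM.phi_le r hr.1 _ (hM.W_mem_sqrtL_domain hr.1 hr.2 hψ))
        (flux_nonneg _ _ _ zero_le_one) ((norm_nonneg _).trans (hYc r))

lemma hasDerivWithinAt_norm_sq_W {r t : ℝ} (hr : r ∈ Set.Icc 0 t) {ψ : H} (hψ : ψ ∈ M.D) :
    HasDerivWithinAt (fun r => ‖M.W r t ψ‖ ^ 2) (M.flux t ψ r 1) (Set.Icc 0 t) r := by
  let : InnerProductSpace ℝ H := InnerProductSpace.rclikeToReal ℂ H
  have hφ : M.W r t ψ ∈ M.D := hM.W_mem r t hr.1 hr.2 ψ hψ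
  have hderiv : HasDerivWithinAt (fun r => ‖M.W r t ψ‖ ^ 2)
      (2 * ⟪M.W r t ψ, app (M.G r) (M.W r t ψ)⟫_ℝ) (Set.Icc 0 t) r :=
    (hM.W_deriv_left r t hr.1 hr.2 ψ hψ).norm_sq
  convert hderiv using 1
  set φ := M.W r t ψ
  have hadj := LinearPMap.adjoint_isFormalAdjoint (hM.G_dense r hr.1)
    ⟨φ, hM.D_le_adjoint r hr.1 hφ⟩ ⟨φ, (hM.G_core r hr.1).le_domain hφ⟩
  rw [← app_of_mem, ← app_of_mem] at hadj
  calc M.flux t ψ r 1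
      = (⟪φ, app (M.G r).adjoint φ + app (M.G r) φ⟫_ℂ).re := by
        rw [hM.adjoint_add r hr.1 φ hφ φ hφ]
        rfl
    _ = 2 * (⟪φ, app (M.G r) φ⟫_ℂ).re := by
        rw [inner_add_right, Complex.add_re, ← inner_conj_symm φ (app (M.G r).adjoint φ), hadj,
          Complex.conj_re, two_mul]

lemma integral_flux_one {s t : ℝ} (hs : 0 ≤ s) (hst : s ≤ t) {ψ : H} (hψ : ψ ∈ M.D) :
    ∫ r in s..t, M.flux t ψ r 1 = ‖ψ‖ ^ 2 - ‖M.W s t ψ‖ ^ 2 := by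
  have ht := hs.trans hst
  have hint : IntegrableOn (fun r => M.flux t ψ r 1) (Set.Icc 0 t) :=
    hM.integrableOn_flux ht hψ (fun _ => zero_le_one) (fun χ => measurable_const) fun _ => le_rfl
  rw [intervalIntegral.integral_eq_sub_of_hasDerivAt_of_le (f := fun r => ‖M.W r t ψ‖ ^ 2) hst
    (fun r hr => (hM.hasDerivWithinAt_norm_sq_W ⟨hs.trans hr.1, hr.2⟩ hψ).continuousWithinAt.mono
      (Set.Icc_subset_Icc_left hs))
    (fun r hr => (hM.hasDerivWithinAt_norm_sq_W ⟨hs.trans hr.1.le, hr.2.le⟩ hψ).hasDerivAt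
      (Icc_mem_nhds (hs.trans_lt hr.1) hr.2))
    ((intervalIntegrable_iff_integrableOn_Icc_of_le hst).2
      (hint.mono_set (Set.Icc_subset_Icc_left hs))), hM.W_self t ht]
  rfl

end Assumptions

end Data

/-! ### One step of the iteration -/

/-- A weakly continuous family of positive operators on `[s, ∞)` of norm at most `c`; the values
for `r < s` are arbitrary. The iterates `t ↦ P⁽ⁿ⁾_{s,t}(X)`, `X ≥ 0`, are such families. -/
structure RegularFamily (s c : ℝ) (Y : ℝ → H →L[ℂ] H) : Prop where
  nonneg : ∀ r, s ≤ r → 0 ≤ Y r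
  norm_le : ∀ r, s ≤ r → ‖Y r‖ ≤ c
  continuousOn : ∀ χ, ContinuousOn (fun r => quadForm (Y r) χ) (Set.Ici s)

namespace RegularFamily

variable {s c : ℝ} {Y : ℝ → H →L[ℂ] H}

lemma bound_nonneg (h : RegularFamily s c Y) : 0 ≤ c :=
  (norm_nonneg _).trans (h.norm_le s le_rfl)

lemma measurable_max (h : RegularFamily s c Y) (χ : H) :
    Measurable fun r => quadForm (Y (max s r)) χ :=
  ((h.continuousOn χ).comp_continuous (f := fun r => max s r) (by fun_prop)
    fun r => le_max_left s r).measurable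

lemma one [CompleteSpace H] (s : ℝ) : RegularFamily s 1 fun _ => (1 : H →L[ℂ] H) where
  nonneg _ _ := zero_le_one
  norm_le _ _ := ContinuousLinearMap.norm_id_le
  continuousOn _ := continuousOn_const

end RegularFamily

namespace Data

variable [CompleteSpace H] {M : Data H}

lemma quadForm_V (s t : ℝ) (X : H →L[ℂ] H) (ψ : H) :
    quadForm (M.V s t X) ψ = quadForm X (M.W s t ψ) := by
  simp only [quadForm, V, ContinuousLinearMap.comp_apply,
    ContinuousLinearMap.adjoint_inner_right]

lemma V_nonneg (s t : ℝ) {X : H →L[ℂ] H} (hX : 0 ≤ X) : 0 ≤ M.V s t X := by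
  rw [ContinuousLinearMap.nonneg_iff_isPositive] at *
  exact hX.adjoint_conj _

variable (M) in
/-- The bounded operator with the form `V_{s,t}(X) + ∫_s^t V_{r,t} Φ_r(Y_r) dr`: for
`Y_r = P⁽ⁿ⁾_{s,r}(X)` this is `P⁽ⁿ⁺¹⁾_{s,t}(X)`. -/
def step (s : ℝ) (X : H →L[ℂ] H) (Y : ℝ → H →L[ℂ] H) (t : ℝ) : H →L[ℂ] H :=
  opOfForm M.D fun ψ => ⟪ψ, M.V s t X ψ⟫_ℂ + ∫ r in s..t, M.phi r (Y r) (M.W r t ψ) (M.W r t ψ)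

lemma integral_flux_nonneg {s a t c : ℝ} (hsa : s ≤ a) (hat : a ≤ t) {ψ : H}
    {Y : ℝ → H →L[ℂ] H} (hY : RegularFamily s c Y) :
    0 ≤ ∫ r in a..t, M.flux t ψ r (Y r) :=
  intervalIntegral.integral_nonneg hat fun r hr => flux_nonneg t ψ r (hY.nonneg r (hsa.trans hr.1))

lemma integral_phi_eq {s t c : ℝ} (hst : s ≤ t) (ψ : H) {Y : ℝ → H →L[ℂ] H}
    (hY : RegularFamily s c Y) : ∫ r in s..t, M.phi r (Y r) (M.W r t ψ) (M.W r t ψ)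
      = ((∫ r in s..t, M.flux t ψ r (Y r) : ℝ) : ℂ) := by
  rw [← intervalIntegral.integral_ofReal]
  refine intervalIntegral.integral_congr fun r hr => phi_eq_flux t ψ r (hY.nonneg r ?_)
  rw [Set.uIcc_of_le hst] at hr
  exact hr.1

namespace Assumptions

variable (hM : M.Assumptions)
include hM

lemma integrableOn_flux_of_regularFamily {s t c : ℝ} (hs : 0 ≤ s) (hst : s ≤ t) {ψ : H}
    (hψ : ψ ∈ M.D) {Y : ℝ → H →L[ℂ] H} (hY : RegularFamily s c Y) :
    IntegrableOn (fun r => M.flux t ψ r (Y r)) (Set.Icc s t) := by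
  have h := hM.integrableOn_flux (hs.trans hst) hψ (Y := fun r => Y (max s r))
    (fun r => hY.nonneg _ (le_max_left _ _)) hY.measurable_max
    (fun r => hY.norm_le _ (le_max_left _ _))
  refine (h.mono_set (Set.Icc_subset_Icc_left hs)).congr_fun (fun r hr => ?_) measurableSet_Icc
  simp only [max_eq_right hr.1]

lemma intervalIntegrable_flux {s a b t c : ℝ} (hs : 0 ≤ s) (hsa : s ≤ a) (hab : a ≤ b)
    (hbt : b ≤ t) {ψ : H} (hψ : ψ ∈ M.D) {Y : ℝ → H →L[ℂ] H} (hY : RegularFamily s c Y) :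
    IntervalIntegrable (fun r => M.flux t ψ r (Y r)) volume a b :=
  (intervalIntegrable_iff_integrableOn_Icc_of_le hab).2
    ((hM.integrableOn_flux_of_regularFamily hs (hsa.trans (hab.trans hbt)) hψ hY).mono_set
      (Set.Icc_subset_Icc hsa hbt))

lemma integral_flux_le {s a t c : ℝ} (hs : 0 ≤ s) (hsa : s ≤ a) (hat : a ≤ t) {ψ : H}
    (hψ : ψ ∈ M.D) {Y : ℝ → H →L[ℂ] H} (hY : RegularFamily s c Y) :
    ∫ r in a..t, M.flux t ψ r (Y r) ≤ c * (‖ψ‖ ^ 2 - ‖M.W a t ψ‖ ^ 2) := by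
  rw [← hM.integral_flux_one (hs.trans hsa) hat hψ, ← intervalIntegral.integral_const_mul]
  refine intervalIntegral.integral_mono_on hat
    (hM.intervalIntegrable_flux hs hsa hat le_rfl hψ hY)
    ((hM.intervalIntegrable_flux hs hsa hat le_rfl hψ (.one s)).const_mul c) fun r hr => ?_
  have hsr := hsa.trans hr.1
  exact (flux_le_norm_mul t ψ r (hY.nonneg r hsr)).trans
    (mul_le_mul_of_nonneg_right (hY.norm_le r hsr) (flux_nonneg _ _ _ zero_le_one))

lemma exists_op_integral_flux {s t c : ℝ} (hs : 0 ≤ s) (hst : s ≤ t) {Y : ℝ → H →L[ℂ] H}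
    (hY : RegularFamily s c Y) : ∃ T : H →L[ℂ] H, ∀ ψ ∈ M.D,
      ⟪ψ, T ψ⟫_ℂ = ∫ r in s..t, M.phi r (Y r) (M.W r t ψ) (M.W r t ψ) := by
  obtain ⟨S, hS⟩ := hM.exists_linearMap_app
  let u (r : Set.Icc s t) : M.D →ₗ[ℂ] H := S ∘ₗ
    ((M.W r t).toLinearMap ∘ₗ M.D.subtype).codRestrict M.D
      fun x => hM.W_mem r t (hs.trans r.2.1) r.2.2 x x.2
  have hu : ∀ (r : Set.Icc s t) (x : M.D), u r x = app M.sqrtL (M.W r t x) := fun r x => hS _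
  have hphi : ∀ (x : M.D) (r : Set.Icc s t),
      ⟪u r x, M.A r (Y r) (u r x)⟫_ℂ = M.phi r (Y r) (M.W r t x) (M.W r t x) := fun x r => by
    rw [hu, phi]
  have hint : ∀ x : M.D, Integrable (fun r : Set.Icc s t => ⟪u r x, M.A r (Y r) (u r x)⟫_ℂ)
      (volume.comap Subtype.val) := fun x => by
    have h := (hM.integrableOn_flux_of_regularFamily hs hst x.2 hY).ofReal (𝕜 := ℂ)
    refine ((integrableOn_iff_comap_subtypeVal measurableSet_Icc).1 h).congr
      (.of_forall fun r => ?_)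
    exact (phi_eq_flux t (x : H) r (hY.nonneg r r.2.1)).symm.trans (hphi x r).symm
  have hval : ∀ x : M.D, ∫ r : Set.Icc s t, ⟪u r x, M.A r (Y r) (u r x)⟫_ℂ ∂volume.comap Subtype.val
      = ∫ r in s..t, M.phi r (Y r) (M.W r t x) (M.W r t x) := fun x => by
    simp only [hphi]
    rw [intervalIntegral.integral_of_le hst, ← integral_Icc_eq_integral_Ioc,
      ← integral_subtype_comap measurableSet_Icc fun r => M.phi r (Y r) (M.W r t x) (M.W r t x)]
  obtain ⟨T, hT⟩ := exists_op_integral (e := M.D.subtype) hM.dense_D.denseRange_val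
    (fun r : Set.Icc s t => A_nonneg (M := M) r (hY.nonneg r r.2.1)) u hint (C := c) fun x => by
      rw [hval, integral_phi_eq hst (x : H) hY, Complex.ofReal_re]
      exact (hM.integral_flux_le hs le_rfl hst x.2 hY).trans
        (mul_le_mul_of_nonneg_left (sub_le_self _ (sq_nonneg _)) hY.bound_nonneg)
  exact ⟨T, fun ψ hψ => (hT ⟨ψ, hψ⟩).trans (hval ⟨ψ, hψ⟩)⟩

section Step

variable {s c : ℝ} (hs : 0 ≤ s) {X : H →L[ℂ] H} (hX : 0 ≤ X)
  {Y : ℝ → H →L[ℂ] H} (hY : RegularFamily s c Y)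
include hs hX hY

lemma inner_step {t : ℝ} (hst : s ≤ t) {ψ : H} (hψ : ψ ∈ M.D) :
    ⟪ψ, M.step s X Y t ψ⟫_ℂ
      = ((quadForm X (M.W s t ψ) + ∫ r in s..t, M.flux t ψ r (Y r) : ℝ) : ℂ) := by
  obtain ⟨T, hT⟩ := hM.exists_op_integral_flux hs hst hY
  unfold step
  rw [opOfForm_apply ⟨M.V s t X + T, fun ψ hψ => by rw [add_apply, inner_add_right, hT ψ hψ]⟩ hψ,
    integral_phi_eq hst ψ hY, inner_eq_quadForm (V_nonneg s t hX).isSelfAdjoint, quadForm_V,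
    Complex.ofReal_add]

lemma quadForm_step {t : ℝ} (hst : s ≤ t) {ψ : H} (hψ : ψ ∈ M.D) :
    quadForm (M.step s X Y t) ψ
      = quadForm X (M.W s t ψ) + ∫ r in s..t, M.flux t ψ r (Y r) := by
  rw [quadForm, hM.inner_step hs hX hY hst hψ, Complex.ofReal_re]

lemma step_nonneg {t : ℝ} (hst : s ≤ t) : 0 ≤ M.step s X Y t := by
  refine nonneg_of_forall_mem_dense hM.dense_D fun ψ hψ => ?_
  rw [hM.inner_step hs hX hY hst hψ]
  exact_mod_cast add_nonneg (quadForm_nonneg hX _) (integral_flux_nonneg le_rfl hst hY)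

lemma step_le_step {X' : H →L[ℂ] H} {Y' : ℝ → H →L[ℂ] H} {c' : ℝ} (hXX' : X ≤ X')
    (hY' : RegularFamily s c' Y') (hYY' : ∀ r, s ≤ r → Y r ≤ Y' r) {t : ℝ} (hst : s ≤ t) :
    M.step s X Y t ≤ M.step s X' Y' t := by
  have hX' := hX.trans hXX'
  refine le_of_forall_mem_dense hM.dense_D (hM.step_nonneg hs hX hY hst).isSelfAdjoint
    (hM.step_nonneg hs hX' hY' hst).isSelfAdjoint fun ψ hψ => ?_
  rw [hM.quadForm_step hs hX hY hst hψ, hM.quadForm_step hs hX' hY' hst hψ]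
  exact add_le_add (quadForm_mono hXX' _) (intervalIntegral.integral_mono_on hst
    (hM.intervalIntegrable_flux hs le_rfl hst le_rfl hψ hY)
    (hM.intervalIntegrable_flux hs le_rfl hst le_rfl hψ hY')
    fun r hr => flux_mono t ψ r (hYY' r hr.1))

lemma norm_step_le (hXc : ‖X‖ ≤ c) {t : ℝ} (hst : s ≤ t) : ‖M.step s X Y t‖ ≤ c := by
  refine norm_le_of_quadForm_le (hM.step_nonneg hs hX hY hst) hY.bound_nonneg fun χ => ?_
  refine hM.dense_D.induction (P := fun χ => quadForm (M.step s X Y t) χ ≤ c * ‖χ‖ ^ 2)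
    (fun ψ hψ => ?_) (isClosed_le (continuous_quadForm _) (by fun_prop)) χ
  calc quadForm (M.step s X Y t) ψ
      = quadForm X (M.W s t ψ) + ∫ r in s..t, M.flux t ψ r (Y r) := hM.quadForm_step hs hX hY hst hψ
    _ ≤ c * ‖M.W s t ψ‖ ^ 2 + c * (‖ψ‖ ^ 2 - ‖M.W s t ψ‖ ^ 2) :=
        add_le_add ((quadForm_le_norm_mul _ _).trans (by gcongr))
          (hM.integral_flux_le hs le_rfl hst hψ hY)
    _ = c * ‖ψ‖ ^ 2 := by ring

lemma quadForm_step_split {t t' : ℝ} (hst : s ≤ t) (htt' : t ≤ t') {ψ : H} (hψ : ψ ∈ M.D) :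
    quadForm (M.step s X Y t') ψ
      = quadForm (M.step s X Y t) (M.W t t' ψ) + ∫ r in t..t', M.flux t' ψ r (Y r) := by
  have hflux : ∫ r in s..t, M.flux t' ψ r (Y r) = ∫ r in s..t, M.flux t (M.W t t' ψ) r (Y r) := by
    refine intervalIntegral.integral_congr fun r hr => ?_
    rw [Set.uIcc_of_le hst] at hr
    simp only [flux, hM.W_apply_W_apply (hs.trans hr.1) hr.2 htt']
  rw [hM.quadForm_step hs hX hY (hst.trans htt') hψ,
    hM.quadForm_step hs hX hY hst (hM.W_mem t t' (hs.trans hst) htt' ψ hψ),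
    hM.W_apply_W_apply hs hst htt', ← intervalIntegral.integral_add_adjacent_intervals
      (hM.intervalIntegrable_flux hs le_rfl hst htt' hψ hY)
      (hM.intervalIntegrable_flux hs hst htt' le_rfl hψ hY), hflux, add_assoc]

lemma abs_quadForm_step_sub_le (hXc : ‖X‖ ≤ c) {t t' : ℝ} (hst : s ≤ t) (htt' : t ≤ t') (χ : H) :
    |quadForm (M.step s X Y t') χ - quadForm (M.step s X Y t) χ|
      ≤ 4 * c * ‖χ‖ * ‖M.W t t' χ - χ‖ := by
  refine hM.dense_D.induction (P := fun χ => |quadForm (M.step s X Y t') χ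
      - quadForm (M.step s X Y t) χ| ≤ 4 * c * ‖χ‖ * ‖M.W t t' χ - χ‖) (fun ψ hψ => ?_)
    (isClosed_le ((continuous_quadForm _).sub (continuous_quadForm _)).abs (by fun_prop)) χ
  have ht := hs.trans hst
  have hc := hY.bound_nonneg
  have hW := hM.norm_W_apply_le ht htt' ψ
  have hform : |quadForm (M.step s X Y t) (M.W t t' ψ) - quadForm (M.step s X Y t) ψ|
      ≤ c * (‖ψ‖ + ‖ψ‖) * ‖M.W t t' ψ - ψ‖ := by
    refine (abs_quadForm_sub_quadForm_le _ _ _).trans ?_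
    gcongr
    exact hM.norm_step_le hs hX hY hXc hst
  have hflux : ∫ r in t..t', M.flux t' ψ r (Y r) ≤ c * (‖ψ‖ + ‖ψ‖) * ‖M.W t t' ψ - ψ‖ := by
    calc ∫ r in t..t', M.flux t' ψ r (Y r) ≤ c * (‖ψ‖ ^ 2 - ‖M.W t t' ψ‖ ^ 2) :=
          hM.integral_flux_le hs hst htt' hψ hY
      _ = c * (‖ψ‖ + ‖M.W t t' ψ‖) * (‖ψ‖ - ‖M.W t t' ψ‖) := by ring
      _ ≤ c * (‖ψ‖ + ‖ψ‖) * ‖M.W t t' ψ - ψ‖ := by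
        gcongr
        exact norm_sub_rev (M.W t t' ψ) ψ ▸ norm_sub_norm_le _ _
  rw [hM.quadForm_step_split hs hX hY hst htt' hψ, add_sub_right_comm]
  refine (abs_add_le _ _).trans ?_
  rw [abs_of_nonneg (integral_flux_nonneg hst htt' hY)]
  linarith

end Step

lemma continuousOn_of_abs_sub_le {s C : ℝ} (hs : 0 ≤ s) {χ : H} {f : ℝ → ℝ}
    (hf : ∀ t t', s ≤ t → t ≤ t' → |f t' - f t| ≤ C * ‖M.W t t' χ - χ‖) :
    ContinuousOn f (Set.Ici s) := by
  intro t₀ ht₀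
  have hs0 : s ≤ t₀ := ht₀
  have hpair : ContinuousWithinAt (fun t => M.W (min t t₀) (max t t₀) χ) (Set.Ici s) t₀ :=
    (hM.W_cont χ (min t₀ t₀, max t₀ t₀) ⟨by simpa using hs.trans hs0, by simp⟩).comp
      (f := fun t => (min t t₀, max t t₀)) (by fun_prop)
      fun t ht => ⟨le_min (hs.trans ht) (hs.trans hs0), min_le_max⟩
  have hlim : Tendsto (fun t => C * ‖M.W (min t t₀) (max t t₀) χ - χ‖) (𝓝[Set.Ici s] t₀) (𝓝 0) := by
    have h : Tendsto _ _ _ := (hpair.sub (continuousWithinAt_const (b := χ))).norm.const_mul C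
    simpa [hM.W_self t₀ (hs.trans hs0)] using h
  refine tendsto_iff_dist_tendsto_zero.2
    (squeeze_zero' (.of_forall fun t => dist_nonneg) ?_ hlim)
  filter_upwards [self_mem_nhdsWithin] with t ht
  rw [Real.dist_eq]
  rcases le_total t t₀ with h | h
  · rw [min_eq_left h, max_eq_right h, abs_sub_comm]
    exact hf t t₀ ht h
  · rw [min_eq_right h, max_eq_left h]
    exact hf t₀ t hs0 h

lemma regularFamily_step {s c : ℝ} (hs : 0 ≤ s) {X : H →L[ℂ] H} (hX : 0 ≤ X) (hXc : ‖X‖ ≤ c)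
    {Y : ℝ → H →L[ℂ] H} (hY : RegularFamily s c Y) : RegularFamily s c (M.step s X Y) where
  nonneg _ hr := hM.step_nonneg hs hX hY hr
  norm_le _ hr := hM.norm_step_le hs hX hY hXc hr
  continuousOn χ := hM.continuousOn_of_abs_sub_le hs fun _ _ ht htt' =>
    hM.abs_quadForm_step_sub_le hs hX hY hXc ht htt' χ

lemma regularFamily_V {s : ℝ} (hs : 0 ≤ s) {X : H →L[ℂ] H} (hX : 0 ≤ X) :
    RegularFamily s ‖X‖ (fun t => M.V s t X) where
  nonneg r _ := V_nonneg s r hX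
  norm_le r hr := norm_le_of_quadForm_le (V_nonneg s r hX) (norm_nonneg X) fun χ => by
    rw [quadForm_V]
    refine (quadForm_le_norm_mul _ _).trans ?_
    gcongr
    exact hM.norm_W_apply_le hs hr χ
  continuousOn χ := by
    simp only [quadForm_V]
    exact (continuous_quadForm X).comp_continuousOn
      ((hM.W_cont χ).comp (f := fun t => (s, t)) (by fun_prop) fun t ht => ⟨hs, ht⟩)

end Assumptions

end Data

/-! ### The iteration -/

namespace Data

variable [CompleteSpace H] {M : Data H}

lemma quadForm_iter_zero (s t : ℝ) (X : H →L[ℂ] H) (ψ : H) :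
    quadForm (M.iter 0 s t X) ψ = quadForm X (M.W s t ψ) :=
  quadForm_V s t X ψ

namespace Assumptions

variable (hM : M.Assumptions) {s : ℝ} (hs : 0 ≤ s) {X : H →L[ℂ] H} (hX : 0 ≤ X)
include hM hs hX

lemma regularFamily_iter (n : ℕ) : RegularFamily s ‖X‖ (fun t => M.iter n s t X) := by
  induction n with
  | zero => exact hM.regularFamily_V hs hX
  | succ n ih => exact hM.regularFamily_step hs hX le_rfl ih

lemma iter_nonneg (n : ℕ) {t : ℝ} (hst : s ≤ t) : 0 ≤ M.iter n s t X :=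
  (hM.regularFamily_iter hs hX n).nonneg t hst

lemma quadForm_iter_succ (n : ℕ) {t : ℝ} (hst : s ≤ t) {ψ : H} (hψ : ψ ∈ M.D) :
    quadForm (M.iter (n + 1) s t X) ψ
      = quadForm X (M.W s t ψ) + ∫ r in s..t, M.flux t ψ r (M.iter n s r X) :=
  hM.quadForm_step hs hX (hM.regularFamily_iter hs hX n) hst hψ

lemma iter_le_iter {X' : H →L[ℂ] H} (hXX' : X ≤ X') (n : ℕ) {t : ℝ} (hst : s ≤ t) :
    M.iter n s t X ≤ M.iter n s t X' := by
  induction n generalizing t with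
  | zero =>
    refine le_of_forall_mem_dense dense_univ (hM.iter_nonneg hs hX 0 hst).isSelfAdjoint
      (hM.iter_nonneg hs (hX.trans hXX') 0 hst).isSelfAdjoint fun ψ _ => ?_
    simpa only [quadForm_iter_zero] using quadForm_mono hXX' _
  | succ n ih =>
    exact hM.step_le_step hs hX (hM.regularFamily_iter hs hX n) hXX'
      (hM.regularFamily_iter hs (hX.trans hXX') n) (fun r hr => ih hr) hst

lemma iter_le_succ (n : ℕ) {t : ℝ} (hst : s ≤ t) : M.iter n s t X ≤ M.iter (n + 1) s t X := by
  induction n generalizing t with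
  | zero =>
    refine le_of_forall_mem_dense hM.dense_D (hM.iter_nonneg hs hX 0 hst).isSelfAdjoint
      (hM.iter_nonneg hs hX 1 hst).isSelfAdjoint fun ψ hψ => ?_
    rw [hM.quadForm_iter_succ hs hX 0 hst hψ, quadForm_iter_zero]
    exact le_add_of_nonneg_right
      (integral_flux_nonneg le_rfl hst (hM.regularFamily_iter hs hX 0))
  | succ n ih =>
    exact hM.step_le_step hs hX (hM.regularFamily_iter hs hX n) le_rfl
      (hM.regularFamily_iter hs hX (n + 1)) (fun r hr => ih hr) hst

lemma monotone_iter {t : ℝ} (hst : s ≤ t) : Monotone fun n => M.iter n s t X :=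
  monotone_nat_of_le_succ fun n => hM.iter_le_succ hs hX n hst

lemma quadForm_iter_self (n : ℕ) (χ : H) : quadForm (M.iter n s s X) χ = quadForm X χ := by
  refine congrFun (Continuous.ext_on hM.dense_D (continuous_quadForm _) (continuous_quadForm _)
    fun ψ hψ => ?_) χ
  cases n with
  | zero => rw [quadForm_iter_zero, hM.W_self s hs, one_apply_eq_self]
  | succ n =>
    rw [hM.quadForm_iter_succ hs hX n le_rfl hψ, intervalIntegral.integral_same, add_zero,
      hM.W_self s hs, one_apply_eq_self]

lemma isLUB_pMin {t : ℝ} (hst : s ≤ t) :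
    IsLUB (Set.range fun n => M.iter n s t X) (M.pMin s t X) := by
  have h : ∃ T, IsLUB (Set.range fun n => M.iter n s t X) T :=
    exists_isLUB_of_monotone (hM.monotone_iter hs hX hst)
      fun n => (hM.regularFamily_iter hs hX n).norm_le t hst
  unfold pMin
  rw [dif_pos h]
  exact h.choose_spec

lemma iter_le_pMin (n : ℕ) {t : ℝ} (hst : s ≤ t) : M.iter n s t X ≤ M.pMin s t X :=
  (hM.isLUB_pMin hs hX hst).1 ⟨n, rfl⟩

end Assumptions

end Data

/-! ### Bounded minorants of `Φₛ(I)` -/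

section Regularization

lemma isGLB_norm_sub_sq {E : Type*} [NormedAddCommGroup E] [InnerProductSpace ℂ E]
    [CompleteSpace E] (R : Submodule ℂ E) (v : E) :
    IsGLB (Set.range fun z : R => ‖v - z‖ ^ 2) (‖Rᗮ.starProjection v‖ ^ 2) := by
  refine ⟨?_, fun l hl => ?_⟩
  · rintro _ ⟨z, rfl⟩
    have hz : Rᗮ.starProjection (z : E) = 0 :=
      Rᗮ.starProjection_apply_eq_zero_iff.2 (R.le_orthogonal_orthogonal z.2)
    calc ‖Rᗮ.starProjection v‖ ^ 2 = ‖Rᗮ.starProjection (v - z)‖ ^ 2 := by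
          rw [map_sub, hz, sub_zero]
      _ ≤ ‖v - z‖ ^ 2 := by
          gcongr
          exact Rᗮ.norm_starProjection_apply_le _
  · have hmem : v - Rᗮ.starProjection v ∈ closure (R : Set E) := by
      rw [← Submodule.topologicalClosure_coe, ← R.orthogonal_orthogonal_eq_closure]
      exact Rᗮ.sub_starProjection_mem_orthogonal v
    have hl' : closure (R : Set E) ⊆ {z | l ≤ ‖v - z‖ ^ 2} :=
      closure_minimal (fun z hz => hl ⟨⟨z, hz⟩, rfl⟩) (isClosed_le continuous_const (by fun_prop))
    exact (hl' hmem).trans_eq (by rw [sub_sub_cancel])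

lemma exists_quadForm_isGLB_norm_sub_sq {E : Type*} [NormedAddCommGroup E] [InnerProductSpace ℂ E]
    [CompleteSpace E] [CompleteSpace H] (ι : H →L[ℂ] E) (R : Submodule ℂ E) :
    ∃ X : H →L[ℂ] H, 0 ≤ X ∧
      ∀ ψ, IsGLB (Set.range fun z : R => ‖ι ψ - z‖ ^ 2) (quadForm X ψ) := by
  let P := Rᗮ.starProjection
  refine ⟨ι.adjoint ∘L P ∘L ι, ?_, fun ψ => ?_⟩
  · rw [ContinuousLinearMap.nonneg_iff_isPositive]
    have hP : IsStarProjection P := isStarProjection_starProjection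
    exact (ContinuousLinearMap.IsPositive.of_isStarProjection hP).adjoint_conj ι
  · have hquad : quadForm (ι.adjoint ∘L P ∘L ι) ψ = ‖P (ι ψ)‖ ^ 2 := by
      rw [quadForm, ContinuousLinearMap.comp_apply, ContinuousLinearMap.adjoint_inner_right,
        ← inner_conj_symm, Complex.conj_re]
      exact Rᗮ.re_inner_starProjection_eq_normSq _
    rw [hquad]
    exact isGLB_norm_sub_sq R (ι ψ)

/-- The Moreau regularization of a quadratic form `‖u ·‖²` is the form of a bounded operator: it is
the squared distance of `(√m ψ, 0)` to the subspace of the vectors `(√m χ, u χ)`. -/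
lemma exists_quadForm_isGLB [CompleteSpace H] {D : Submodule ℂ H} (u : D →ₗ[ℂ] H) {m : ℝ}
    (hm : 0 ≤ m) : ∃ X : H →L[ℂ] H, 0 ≤ X ∧ ∀ ψ : H,
      IsGLB (Set.range fun χ : D => ‖u χ‖ ^ 2 + m * ‖ψ - χ‖ ^ 2) (quadForm X ψ) := by
  let e : (H × H) ≃L[ℂ] WithLp 2 (H × H) := (WithLp.prodContinuousLinearEquiv 2 ℂ H H).symm
  let j : D →ₗ[ℂ] WithLp 2 (H × H) := e.toLinearMap ∘ₗ ((√m : ℂ) • D.subtype).prod u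
  let ι : H →L[ℂ] WithLp 2 (H × H) :=
    e.toContinuousLinearMap ∘L ((√m : ℂ) • ContinuousLinearMap.id ℂ H).prod 0
  have hnorm : ∀ ψ (χ : D), ‖ι ψ - j χ‖ ^ 2 = ‖u χ‖ ^ 2 + m * ‖ψ - χ‖ ^ 2 := fun ψ χ => by
    have hsub : ι ψ - j χ = WithLp.toLp 2 ((√m : ℂ) • (ψ - χ), - u χ) := by
      rw [smul_sub, ← zero_sub (u χ), ← Prod.mk_sub_mk, WithLp.toLp_sub]
      rfl
    rw [hsub, WithLp.prod_norm_sq_eq_of_L2, WithLp.toLp_fst, WithLp.toLp_snd, norm_smul, norm_neg,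
      mul_pow, Complex.norm_real, Real.norm_eq_abs, sq_abs, Real.sq_sqrt hm, add_comm]
  obtain ⟨X, hX, hglb⟩ := exists_quadForm_isGLB_norm_sub_sq ι (LinearMap.range j)
  refine ⟨X, hX, fun ψ => ?_⟩
  have h := hglb ψ
  rw [← j.surjective_rangeRestrict.range_comp] at h
  simp only [← hnorm]
  exact h

lemma measurable_of_isGLB_range {ι α : Type*} [TopologicalSpace α] [MeasurableSpace α]
    [OpensMeasurableSpace α] {f : ι → α → ℝ} (hf : ∀ i, Continuous (f i)) {g : α → ℝ}
    (hg : ∀ a, IsGLB (Set.range fun i => f i a) (g a)) : Measurable g := by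
  refine measurable_of_Iio fun b => IsOpen.measurableSet ?_
  have hset : g ⁻¹' Set.Iio b = ⋃ i, f i ⁻¹' Set.Iio b := by
    ext a
    simp [isGLB_lt_iff (hg a)]
  rw [hset]
  exact isOpen_iUnion fun i => isOpen_Iio.preimage (hf i)

end Regularization

namespace Data

variable [CompleteSpace H] (M : Data H)

/-- An increasing sequence of bounded positive operators `X m s ≤ Φₛ(I)`, weakly measurable in `s`,
whose forms converge to the form of `Φₛ(I)` on the core. -/
structure IsMinorantSequence (X : ℕ → ℝ → H →L[ℂ] H) : Prop where
  nonneg : ∀ m s, 0 ≤ X m s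
  monotone : ∀ s, Monotone fun m => X m s
  measurable : ∀ m χ, Measurable fun s => quadForm (X m s) χ
  mem_minorants : ∀ m s, 0 ≤ s → X m s ∈ M.minorants s
  iSup_quadForm : ∀ s, 0 ≤ s → ∀ ψ ∈ M.D,
    ⨆ m, ENNReal.ofReal (quadForm (X m s) ψ) = ENNReal.ofReal (M.phi s 1 ψ ψ).re

variable {M}

namespace Assumptions

variable (hM : M.Assumptions)
include hM

lemma continuous_phi_one (χ : H) : Continuous fun s : ℝ => (M.phi (max 0 s) 1 χ χ).re := by
  have hsingle : Summable fun n => ‖(Pi.single 0 (app M.sqrtL χ) : ℕ → H) n‖ ^ 2 :=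
    (hasSum_single 0 fun n hn => by simp [hn]).summable
  have hphi : ∀ t, ∑' n, ⟪(Pi.single 0 (app M.sqrtL χ) : ℕ → H) n,
      M.A t 1 ((Pi.single 0 (app M.sqrtL χ) : ℕ → H) n)⟫_ℂ = M.phi t 1 χ χ := fun t => by
    rw [tsum_eq_single 0 fun n hn => by simp [hn]]
    simp [phi]
  have h := hM.A_cont 1 _ _ hsingle hsingle
  simp only [hphi] at h
  exact Complex.continuous_re.comp (h.comp_continuous (f := fun s => max 0 s) (by fun_prop)
    fun s => le_max_left 0 s)

/-- Completing the square in `Φₛ(I)[ψ - η] ≥ Φₛ(I)[ψ] - 2 Re ⟪η, Φₛ(I) ψ⟫`, where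
`Φₛ(I) ψ = (Gₛ* + Gₛ) ψ`. -/
lemma phi_one_sub_le {s : ℝ} (hs : 0 ≤ s) {χ ψ : H} (hχ : χ ∈ M.D) (hψ : ψ ∈ M.D) {m : ℝ}
    (hm : 0 < m) : (M.phi s 1 ψ ψ).re - ‖app (M.G s).adjoint ψ + app (M.G s) ψ‖ ^ 2 / m
      ≤ (M.phi s 1 χ χ).re + m * ‖ψ - χ‖ ^ 2 := by
  obtain ⟨S, hS⟩ := hM.exists_linearMap_app
  have hA : 0 ≤ M.A s 1 := A_nonneg s zero_le_one
  set η : M.D := ⟨ψ, hψ⟩ - ⟨χ, hχ⟩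
  set g := ‖app (M.G s).adjoint ψ + app (M.G s) ψ‖
  have hcross : (⟪S η, M.A s 1 (S ⟨ψ, hψ⟩)⟫_ℂ).re ≤ ‖ψ - χ‖ * g := by
    rw [hS, hS, ← phi, ← hM.adjoint_add s hs η η.2 ψ hψ]
    exact (Complex.re_le_norm _).trans (norm_inner_le_norm _ _)
  have hexpand : (M.phi s 1 χ χ).re = (M.phi s 1 ψ ψ).re
      - 2 * (⟪S η, M.A s 1 (S ⟨ψ, hψ⟩)⟫_ℂ).re + quadForm (M.A s 1) (S η) := by
    have hχη : app M.sqrtL χ = S ⟨ψ, hψ⟩ - S η := by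
      rw [map_sub, sub_sub_cancel, hS]
    have hsymm : (⟪S ⟨ψ, hψ⟩, M.A s 1 (S η)⟫_ℂ).re = (⟪S η, M.A s 1 (S ⟨ψ, hψ⟩)⟫_ℂ).re := by
      rw [← ((ContinuousLinearMap.nonneg_iff_isPositive _).1 hA).inner_left_eq_inner_right,
        ← inner_conj_symm, Complex.conj_re]
    rw [phi, phi, hχη, ← hS ⟨ψ, hψ⟩, quadForm]
    simp only [map_sub (M.A s 1), inner_sub_left, inner_sub_right, Complex.sub_re]
    linarith
  have hsquare : 2 * (‖ψ - χ‖ * g) ≤ g ^ 2 / m + m * ‖ψ - χ‖ ^ 2 := by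
    have h : 0 ≤ (g - m * ‖ψ - χ‖) ^ 2 / m := by positivity
    have h' : (g - m * ‖ψ - χ‖) ^ 2 / m
        = g ^ 2 / m + m * ‖ψ - χ‖ ^ 2 - 2 * (‖ψ - χ‖ * g) := by
      field_simp
      ring
    linarith
  linarith [quadForm_nonneg hA (S η)]

lemma exists_quadForm_isGLB_phi (s : ℝ) {m : ℝ} (hm : 0 ≤ m) :
    ∃ X : H →L[ℂ] H, 0 ≤ X ∧ ∀ ψ : H, IsGLB
      (Set.range fun χ : M.D => (M.phi s 1 χ χ).re + m * ‖ψ - χ‖ ^ 2) (quadForm X ψ) := by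
  obtain ⟨S, hS⟩ := hM.exists_linearMap_app
  obtain ⟨b, hb⟩ := CStarAlgebra.nonneg_iff_eq_star_mul_self.1 (A_nonneg (M := M) s zero_le_one)
  obtain ⟨X, hX, hglb⟩ := exists_quadForm_isGLB (b.toLinearMap ∘ₗ S) hm
  have hphi : ∀ χ : M.D, (M.phi s 1 χ χ).re = ‖b (S χ)‖ ^ 2 := fun χ => by
    rw [phi, hb, hS, mul_apply_eq_comp, ContinuousLinearMap.star_eq_adjoint,
      ContinuousLinearMap.adjoint_inner_right]
    exact inner_self_eq_norm_sq (𝕜 := ℂ) _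
  exact ⟨X, hX, by simpa only [hphi] using! hglb⟩

lemma iSup_quadForm_eq_phi {s : ℝ} (hs : 0 ≤ s) {X : ℕ → H →L[ℂ] H}
    (hX : ∀ (m : ℕ) (ψ : H), IsGLB
      (Set.range fun χ : M.D => (M.phi s 1 χ χ).re + m * ‖ψ - χ‖ ^ 2) (quadForm (X m) ψ))
    {ψ : H} (hψ : ψ ∈ M.D) :
    ⨆ m, ENNReal.ofReal (quadForm (X m) ψ) = ENNReal.ofReal (M.phi s 1 ψ ψ).re := by
  set g := ‖app (M.G s).adjoint ψ + app (M.G s) ψ‖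
  refine le_antisymm (iSup_le fun m => ENNReal.ofReal_le_ofReal ?_) ?_
  · simpa using (hX m ψ).1 ⟨⟨ψ, hψ⟩, rfl⟩
  have hlim : Tendsto (fun m : ℕ => ENNReal.ofReal ((M.phi s 1 ψ ψ).re - g ^ 2 / m)) atTop
      (𝓝 (ENNReal.ofReal (M.phi s 1 ψ ψ).re)) := by
    refine ENNReal.tendsto_ofReal ?_
    simpa using (tendsto_const_div_atTop_nhds_zero_nat (g ^ 2)).const_sub (M.phi s 1 ψ ψ).re
  refine le_of_tendsto hlim ?_
  filter_upwards [eventually_gt_atTop 0] with m hm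
  refine (ENNReal.ofReal_le_ofReal ((hX m ψ).2 ?_)).trans
    (le_iSup (fun m => ENNReal.ofReal (quadForm (X m) ψ)) m)
  rintro _ ⟨χ, rfl⟩
  exact hM.phi_one_sub_le hs χ.2 hψ (Nat.cast_pos.2 hm)

lemma exists_isMinorantSequence : ∃ X, M.IsMinorantSequence X := by
  choose X hX hglb using fun (m : ℕ) (s : ℝ) =>
    hM.exists_quadForm_isGLB_phi (max 0 s) m.cast_nonneg
  refine ⟨X, hX, fun s m n hmn => ?_, fun m ψ => ?_, fun m s hs => ⟨hX m s, fun ψ hψ => ?_⟩,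
    fun s hs ψ hψ => hM.iSup_quadForm_eq_phi hs (X := fun m => X m s) ?_ hψ⟩
  · refine le_of_forall_mem_dense dense_univ (hX m s).isSelfAdjoint (hX n s).isSelfAdjoint
      fun ψ _ => (hglb n s ψ).2 ?_
    rintro _ ⟨χ, rfl⟩
    refine ((hglb m s ψ).1 ⟨χ, rfl⟩).trans ?_
    dsimp only
    gcongr
  · exact measurable_of_isGLB_range
      (fun χ : M.D => (hM.continuous_phi_one χ).add continuous_const) fun s => hglb m s ψ
  · change quadForm (X m s) ψ ≤ _
    simpa [max_eq_right hs] using (hglb m s ψ).1 ⟨⟨ψ, hψ⟩, rfl⟩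
  · simpa only [max_eq_right hs] using fun m => hglb m s

end Assumptions

end Data

/-! ### Iterations with a time-dependent source -/

section Integrals

variable {α : Type*} [MeasurableSpace α]

lemma measurable_setLIntegral_Icc {F : α → ℝ → ℝ≥0∞} (hF : Measurable (Function.uncurry F))
    {a b : α → ℝ} (ha : Measurable a) (hb : Measurable b) :
    Measurable fun x => ∫⁻ r in Set.Icc (a x) (b x), F x r := by
  have hE : MeasurableSet {p : α × ℝ | a p.1 ≤ p.2 ∧ p.2 ≤ b p.1} :=
    (measurableSet_le (ha.comp measurable_fst) measurable_snd).inter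
      (measurableSet_le measurable_snd (hb.comp measurable_fst))
  convert (hF.indicator hE).lintegral_prod_right' (ν := volume) using 2 with x
  rw [← lintegral_indicator measurableSet_Icc]
  rfl

lemma setLIntegral_triangle_swap {F : ℝ → ℝ → ℝ≥0∞} (hF : Measurable (Function.uncurry F))
    (τ t : ℝ) : ∫⁻ s in Set.Icc τ t, ∫⁻ r in Set.Icc s t, F s r
      = ∫⁻ r in Set.Icc τ t, ∫⁻ s in Set.Icc τ r, F s r := by
  let G : ℝ → ℝ → ℝ≥0∞ := fun s r => {p : ℝ × ℝ | p.1 ≤ p.2}.indicator (Function.uncurry F) (s, r)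
  have hG : AEMeasurable (Function.uncurry G)
      ((volume.restrict (Set.Icc τ t)).prod (volume.restrict (Set.Icc τ t))) :=
    (hF.indicator (measurableSet_le measurable_fst measurable_snd)).aemeasurable
  have hleft : ∀ s ∈ Set.Icc τ t, ∫⁻ r in Set.Icc s t, F s r = ∫⁻ r in Set.Icc τ t, G s r :=
    fun s hs => by
      have hset : Set.Icc s t = Set.Ici s ∩ Set.Icc τ t := by
        rw [← Set.Ici_inter_Iic, ← Set.Ici_inter_Iic, ← Set.inter_assoc, Set.Ici_inter_Ici,
          sup_eq_left.2 hs.1]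
      rw [hset, ← setLIntegral_indicator measurableSet_Ici]
      rfl
  have hright : ∀ r ∈ Set.Icc τ t, ∫⁻ s in Set.Icc τ t, G s r = ∫⁻ s in Set.Icc τ r, F s r :=
    fun r hr => by
      have hset : Set.Icc τ r = Set.Iic r ∩ Set.Icc τ t := by
        rw [← Set.Ici_inter_Iic, ← Set.Ici_inter_Iic, Set.inter_left_comm, Set.Iic_inter_Iic,
          inf_eq_left.2 hr.2]
      rw [hset, ← setLIntegral_indicator measurableSet_Iic]
      rfl
  rw [setLIntegral_congr_fun measurableSet_Icc hleft, lintegral_lintegral_swap hG,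
    setLIntegral_congr_fun measurableSet_Icc hright]

lemma tsum_iSup_of_monotone {ι : Type*} {f : ι → ℕ → ℝ≥0∞} (hf : ∀ k, Monotone (f k)) :
    ∑' k, ⨆ m, f k m = ⨆ m, ∑' k, f k m := by
  simp only [ENNReal.tsum_eq_iSup_sum]
  rw [iSup_comm]
  exact iSup_congr fun a => ENNReal.finsetSum_iSup_of_monotone hf

end Integrals

namespace Data

variable [CompleteSpace H] (M : Data H)

/-- `P⁽ⁿ⁾_{s,r}(X_s)`, extended from `0 ≤ s ≤ r` to all real `s`, `r`: the extension is jointly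
measurable whenever the source `X` is measurable. -/
def clampIter (X : ℝ → H →L[ℂ] H) (n : ℕ) (s r : ℝ) : H →L[ℂ] H :=
  M.iter n (max 0 s) (max (max 0 s) r) (X (max 0 s))

variable {M}

lemma clampIter_of_le (X : ℝ → H →L[ℂ] H) (n : ℕ) {s r : ℝ} (hs : 0 ≤ s) (hsr : s ≤ r) :
    M.clampIter X n s r = M.iter n s r (X s) := by
  simp only [clampIter, max_eq_right hs, max_eq_right hsr]

lemma quadForm_clampIter_zero (X : ℝ → H →L[ℂ] H) (s r : ℝ) (χ : H) :
    quadForm (M.clampIter X 0 s r) χ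
      = quadForm (X (max 0 s)) (M.W (max 0 s) (max (max 0 s) r) χ) :=
  quadForm_iter_zero _ _ _ _

namespace Assumptions

variable (hM : M.Assumptions)
include hM

lemma ofReal_integral_flux {s t c : ℝ} (hs : 0 ≤ s) (hst : s ≤ t) {ψ : H} (hψ : ψ ∈ M.D)
    {Y : ℝ → H →L[ℂ] H} (hY : RegularFamily s c Y) :
    ENNReal.ofReal (∫ r in s..t, M.flux t ψ r (Y r))
      = ∫⁻ r in Set.Icc s t, ENNReal.ofReal (M.flux t ψ r (Y r)) := by
  rw [intervalIntegral.integral_of_le hst, ← integral_Icc_eq_integral_Ioc]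
  refine ofReal_integral_eq_lintegral_ofReal
    (hM.integrableOn_flux_of_regularFamily hs hst hψ hY) ?_
  filter_upwards [ae_restrict_mem measurableSet_Icc] with r hr
  exact flux_nonneg t ψ r (hY.nonneg r hr.1)

lemma ofReal_integral_flux_eq_tsum {s t c : ℝ} (hs : 0 ≤ s) (hst : s ≤ t) {ψ : H} (hψ : ψ ∈ M.D)
    {v : ℕ → ℝ → H} (hv : M.IsKrausFamily t ψ v) {Y : ℝ → H →L[ℂ] H} (hY : RegularFamily s c Y) :
    ENNReal.ofReal (∫ r in s..t, M.flux t ψ r (Y r))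
      = ∫⁻ r in Set.Icc s t, ∑' k, ENNReal.ofReal (quadForm (Y r) (v k r)) := by
  rw [hM.ofReal_integral_flux hs hst hψ hY]
  refine lintegral_congr_ae ?_
  filter_upwards [ae_restrict_of_ae_restrict_of_subset (Set.Icc_subset_Icc_left hs) hv.ofReal_flux,
    ae_restrict_mem measurableSet_Icc] with r hr hrs
  exact hr _ (hY.nonneg r hrs.1)

variable {X : ℝ → H →L[ℂ] H} (hX : ∀ s, 0 ≤ X s)
include hX

lemma clampIter_nonneg (n : ℕ) (s r : ℝ) : 0 ≤ M.clampIter X n s r :=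
  hM.iter_nonneg (le_max_left 0 s) (hX _) n (le_max_left _ r)

lemma continuous_quadForm_clampIter (n : ℕ) (s : ℝ) (χ : H) :
    Continuous fun r => quadForm (M.clampIter X n s r) χ :=
  ((hM.regularFamily_iter (le_max_left 0 s) (hX _) n).continuousOn χ).comp_continuous
    (f := fun r => max (max 0 s) r) (by fun_prop) fun r => le_max_left _ r

lemma ofReal_quadForm_clampIter_succ (n : ℕ) (s : ℝ) {t : ℝ} {ψ : H} (hψ : ψ ∈ M.D)
    {v : ℕ → ℝ → H} (hv : M.IsKrausFamily t ψ v) :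
    ENNReal.ofReal (quadForm (M.clampIter X (n + 1) s t) ψ)
      = ENNReal.ofReal (quadForm (M.clampIter X 0 s t) ψ) + ∫⁻ r in Set.Icc (max 0 s) t,
        ∑' k, ENNReal.ofReal (quadForm (M.clampIter X n s r) (v k r)) := by
  have hs : 0 ≤ max 0 s := le_max_left 0 s
  rcases le_or_gt (max 0 s) t with hst | hts
  · have hreg := hM.regularFamily_iter hs (hX (max 0 s)) n
    have hclamp : ∫⁻ r in Set.Icc (max 0 s) t,
        ∑' k, ENNReal.ofReal (quadForm (M.clampIter X n s r) (v k r))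
          = ∫⁻ r in Set.Icc (max 0 s) t,
            ∑' k, ENNReal.ofReal (quadForm (M.iter n (max 0 s) r (X (max 0 s))) (v k r)) :=
      setLIntegral_congr_fun measurableSet_Icc fun r hr => by
        simp only [clampIter, max_eq_right hr.1]
    rw [hclamp, ← hM.ofReal_integral_flux_eq_tsum hs hst hψ hv hreg, quadForm_clampIter_zero,
      clampIter, max_eq_right hst, hM.quadForm_iter_succ hs (hX _) n hst hψ,
      ENNReal.ofReal_add (quadForm_nonneg (hX _) _) (integral_flux_nonneg le_rfl hst hreg)]
  · rw [Set.Icc_eq_empty hts.not_ge, Measure.restrict_empty, lintegral_zero_measure, add_zero,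
      clampIter, clampIter, max_eq_left hts.le, hM.quadForm_iter_self hs (hX _),
      hM.quadForm_iter_self hs (hX _)]

lemma measurable_tsum_clampIter {n : ℕ}
    (hm : ∀ r χ, Measurable fun s => quadForm (M.clampIter X n s r) χ) {v : ℕ → ℝ → H}
    (hv : ∀ k, StronglyMeasurable (v k)) :
    Measurable (Function.uncurry fun s r =>
      ∑' k, ENNReal.ofReal (quadForm (M.clampIter X n s r) (v k r))) := by
  have hjoint : ∀ χ, Measurable fun p : ℝ × ℝ => quadForm (M.clampIter X n p.1 p.2) χ := fun χ =>
    (measurable_uncurry_of_continuous_of_measurable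
      (u := fun r s => quadForm (M.clampIter X n s r) χ)
      (fun s => hM.continuous_quadForm_clampIter hX n s χ) fun r => hm r χ).comp measurable_swap
  exact Measurable.tsum fun k =>
    (measurable_quadForm_comp hjoint ((hv k).comp_measurable measurable_snd)).ennreal_ofReal

variable (hXm : ∀ χ, Measurable fun s => quadForm (X s) χ)

omit hX in
include hXm in
lemma measurable_quadForm_clampIter_zero (t : ℝ) (χ : H) :
    Measurable fun s => quadForm (M.clampIter X 0 s t) χ := by
  simp only [quadForm_clampIter_zero]
  refine measurable_quadForm_comp (fun χ => (hXm χ).comp (by fun_prop)) ?_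
  exact ((hM.W_cont χ).comp_continuous (f := fun s => (max 0 s, max (max 0 s) t))
    (by fun_prop) fun s => ⟨le_max_left _ _, le_max_left _ _⟩).stronglyMeasurable

include hXm in
lemma measurable_quadForm_clampIter (n : ℕ) (t : ℝ) (χ : H) :
    Measurable fun s => quadForm (M.clampIter X n s t) χ := by
  induction n generalizing t χ with
  | zero => exact hM.measurable_quadForm_clampIter_zero hXm t χ
  | succ n ih =>
    have hcore : ∀ ψ ∈ M.D, Measurable fun s => quadForm (M.clampIter X (n + 1) s t) ψ := by
      intro ψ hψ
      wlog ht : 0 ≤ t generalizing t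
      · have hclamp : ∀ s, M.clampIter X (n + 1) s t = M.clampIter X (n + 1) s (max 0 t) :=
          fun s => by rw [clampIter, clampIter, ← max_assoc, max_eq_left (le_max_left 0 s)]
        simpa only [hclamp] using this (max 0 t) (le_max_left 0 t)
      obtain ⟨v, hv⟩ := hM.exists_isKrausFamily ht hψ
      have hm : Measurable fun s => ENNReal.ofReal (quadForm (M.clampIter X (n + 1) s t) ψ) := by
        simp only [fun s => hM.ofReal_quadForm_clampIter_succ hX n s hψ hv]
        exact (hM.measurable_quadForm_clampIter_zero hXm t ψ).ennreal_ofReal.add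
          (measurable_setLIntegral_Icc (hM.measurable_tsum_clampIter hX ih hv.stronglyMeasurable)
            (measurable_const.max measurable_id) measurable_const)
      simpa only [ENNReal.toReal_ofReal (quadForm_nonneg (hM.clampIter_nonneg hX _ _ _) ψ)]
        using hm.ennreal_toReal
    obtain ⟨u, hu, hlim⟩ := mem_closure_iff_seq_limit.1 (hM.dense_D χ)
    refine measurable_of_tendsto_metrizable (fun j => hcore (u j) (hu j)) ?_
    exact tendsto_pi_nhds.2 fun s => ((continuous_quadForm _).tendsto χ).comp hlim

end Assumptions

end Data

/-! ### Extension of integral representations from a dense set -/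

section Extension

variable {α : Type*} [MeasurableSpace α] {μ : Measure α} {D : Set H} {S : H →L[ℂ] H}

lemma lintegral_quadForm_le_of_dense (hD : Dense D) {Y : α → H →L[ℂ] H}
    (hYm : ∀ χ, Measurable fun a => quadForm (Y a) χ)
    (h : ∀ ψ ∈ D, ∫⁻ a, ENNReal.ofReal (quadForm (Y a) ψ) ∂μ ≤ ENNReal.ofReal (quadForm S ψ))
    (χ : H) : ∫⁻ a, ENNReal.ofReal (quadForm (Y a) χ) ∂μ ≤ ENNReal.ofReal (quadForm S χ) := by
  obtain ⟨u, hu, hlim⟩ := mem_closure_iff_seq_limit.1 (hD χ)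
  have htendsto : ∀ X : H →L[ℂ] H, Tendsto (fun j => ENNReal.ofReal (quadForm X (u j))) atTop
      (𝓝 (ENNReal.ofReal (quadForm X χ))) := fun X =>
    ENNReal.tendsto_ofReal (((continuous_quadForm X).tendsto χ).comp hlim)
  calc ∫⁻ a, ENNReal.ofReal (quadForm (Y a) χ) ∂μ
      = ∫⁻ a, liminf (fun j => ENNReal.ofReal (quadForm (Y a) (u j))) atTop ∂μ :=
        lintegral_congr fun a => (htendsto (Y a)).liminf_eq.symm
    _ ≤ liminf (fun j => ∫⁻ a, ENNReal.ofReal (quadForm (Y a) (u j)) ∂μ) atTop :=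
        lintegral_liminf_le fun j => (hYm (u j)).ennreal_ofReal
    _ ≤ liminf (fun j => ENNReal.ofReal (quadForm S (u j))) atTop :=
        liminf_le_liminf (.of_forall fun j => h (u j) (hu j))
    _ = ENNReal.ofReal (quadForm S χ) := (htendsto S).liminf_eq

lemma two_mul_lintegral_quadForm_le {Y : α → H →L[ℂ] H} (hY : ∀ a, 0 ≤ Y a)
    (hYm : ∀ χ, Measurable fun a => quadForm (Y a) χ) (ψ φ : H) :
    2 * ∫⁻ a, ENNReal.ofReal (quadForm (Y a) ψ) ∂μ
      ≤ ∫⁻ a, ENNReal.ofReal (quadForm (Y a) (ψ + φ)) ∂μ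
        + ∫⁻ a, ENNReal.ofReal (quadForm (Y a) (ψ - φ)) ∂μ := by
  rw [← lintegral_const_mul _ (hYm ψ).ennreal_ofReal, ← lintegral_add_left (hYm _).ennreal_ofReal]
  refine lintegral_mono fun a => ?_
  rw [← ENNReal.ofReal_add (quadForm_nonneg (hY a) _) (quadForm_nonneg (hY a) _),
    quadForm_add_add_quadForm_sub, ← ENNReal.ofReal_ofNat 2, ← ENNReal.ofReal_mul zero_le_two]
  exact ENNReal.ofReal_le_ofReal
    (le_add_of_nonneg_right (mul_nonneg zero_le_two (quadForm_nonneg (hY a) φ)))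

/-- The supremum `F` is only lower semicontinuous, which gives `F ≤ S`. For `S ≤ F`, let `ψ ∈ D`
tend to `χ` in `2 S[ψ] = 2 F[ψ] ≤ F[χ] + F[2ψ - χ] ≤ F[χ] + S[2ψ - χ]`. -/
lemma ofReal_quadForm_eq_iSup_of_dense (hD : Dense D) {Y : ℕ → α → H →L[ℂ] H}
    (hY : ∀ m a, 0 ≤ Y m a) (hYm : ∀ m χ, Measurable fun a => quadForm (Y m a) χ)
    (h : ∀ ψ ∈ D, ENNReal.ofReal (quadForm S ψ)
      = ⨆ m, ∫⁻ a, ENNReal.ofReal (quadForm (Y m a) ψ) ∂μ) (χ : H) :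
    ENNReal.ofReal (quadForm S χ) = ⨆ m, ∫⁻ a, ENNReal.ofReal (quadForm (Y m a) χ) ∂μ := by
  set F : H → ℝ≥0∞ := fun χ => ⨆ m, ∫⁻ a, ENNReal.ofReal (quadForm (Y m a) χ) ∂μ
  have hle : ∀ m χ, ∫⁻ a, ENNReal.ofReal (quadForm (Y m a) χ) ∂μ ≤ ENNReal.ofReal (quadForm S χ) :=
    fun m => lintegral_quadForm_le_of_dense hD (hYm m) fun ψ hψ =>
      (le_iSup (fun m => ∫⁻ a, ENNReal.ofReal (quadForm (Y m a) ψ) ∂μ) m).trans_eq (h ψ hψ).symm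
  refine le_antisymm ?_ (iSup_le fun m => hle m χ)
  have hcont : Continuous fun ψ => ENNReal.ofReal (quadForm S ψ) :=
    ENNReal.continuous_ofReal.comp (continuous_quadForm S)
  have hcore : ∀ ψ ∈ D, 2 * ENNReal.ofReal (quadForm S ψ)
      ≤ F χ + ENNReal.ofReal (quadForm S (ψ + (ψ - χ))) := fun ψ hψ => by
    rw [h ψ hψ, ENNReal.mul_iSup]
    refine iSup_le fun m => (two_mul_lintegral_quadForm_le (hY m) (hYm m) ψ (ψ - χ)).trans ?_
    rw [add_comm, sub_sub_cancel]
    exact add_le_add (le_iSup (fun m => ∫⁻ a, ENNReal.ofReal (quadForm (Y m a) χ) ∂μ) m) (hle m _)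
  have hχ := hD.induction (P := fun ψ => 2 * ENNReal.ofReal (quadForm S ψ)
    ≤ F χ + ENNReal.ofReal (quadForm S (ψ + (ψ - χ)))) hcore
    (isClosed_le ((ENNReal.continuous_const_mul ENNReal.ofNat_ne_top).comp hcont)
      (continuous_const.add (hcont.comp (by fun_prop)))) χ
  rw [sub_self, add_zero, two_mul] at hχ
  exact (ENNReal.add_le_add_iff_right ENNReal.ofReal_ne_top).1 hχ

end Extension

/-! ### The defects of the iterations -/

namespace Data

variable [CompleteSpace H] (M : Data H)

/-- The sum of the defects `I - P⁽ᵏ⁾_{τ,t}(I)`, `k ≤ n`, which is the bounded operator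
`∫_τ^t P⁽ⁿ⁾_{s,t} Φₛ(I) ds`. -/
def defectSum (n : ℕ) (τ t : ℝ) : H →L[ℂ] H :=
  ∑ k ∈ Finset.range (n + 1), (1 - M.iter k τ t 1)

variable {M}

namespace Assumptions

variable (hM : M.Assumptions)
include hM

section Defects

variable {τ : ℝ} (hτ : 0 ≤ τ)
include hτ

lemma iter_one_le_one (n : ℕ) {t : ℝ} (hτt : τ ≤ t) : M.iter n τ t 1 ≤ 1 :=
  have hreg := hM.regularFamily_iter hτ zero_le_one n
  (CStarAlgebra.norm_le_one_iff_of_nonneg _ (hreg.nonneg t hτt)).1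
    ((hreg.norm_le t hτt).trans ContinuousLinearMap.norm_id_le)

lemma regularFamily_defect (n : ℕ) : RegularFamily τ 1 fun t => 1 - M.iter n τ t 1 where
  nonneg _ hr := sub_nonneg.2 (hM.iter_one_le_one hτ n hr)
  norm_le _ hr := norm_one_sub_le (hM.iter_nonneg hτ zero_le_one n hr)
    (hM.iter_one_le_one hτ n hr)
  continuousOn χ := by
    simp only [quadForm_sub]
    exact continuousOn_const.sub ((hM.regularFamily_iter hτ zero_le_one n).continuousOn χ)

lemma regularFamily_defectSum (n : ℕ) : RegularFamily τ (n + 1) (M.defectSum n τ) where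
  nonneg r hr := Finset.sum_nonneg fun k _ => (hM.regularFamily_defect hτ k).nonneg r hr
  norm_le r hr := by
    refine (norm_sum_le_of_le _ fun k _ => (hM.regularFamily_defect hτ k).norm_le r hr).trans_eq ?_
    simp
  continuousOn χ := by
    simp only [defectSum, quadForm_sum]
    exact continuousOn_finsetSum _ fun k _ => (hM.regularFamily_defect hτ k).continuousOn χ

variable {t : ℝ} (hτt : τ ≤ t) {ψ : H} (hψ : ψ ∈ M.D)
include hτt hψ

lemma quadForm_defectSum_zero :
    quadForm (M.defectSum 0 τ t) ψ = ∫ r in τ..t, M.flux t ψ r 1 := by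
  rw [hM.integral_flux_one hτ hτt hψ, defectSum, Finset.sum_range_one, quadForm_sub,
    quadForm_iter_zero, quadForm_one, quadForm_one]

lemma quadForm_defect_succ (n : ℕ) : quadForm (1 - M.iter (n + 1) τ t 1) ψ
    = ∫ r in τ..t, M.flux t ψ r (1 - M.iter n τ r 1) := by
  have hint : ∀ {c : ℝ} {Y : ℝ → H →L[ℂ] H}, RegularFamily τ c Y →
      IntervalIntegrable (fun r => M.flux t ψ r (Y r)) volume τ t := fun hY =>
    hM.intervalIntegrable_flux hτ le_rfl hτt le_rfl hψ hY
  simp only [flux_sub]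
  rw [intervalIntegral.integral_sub (hint (.one τ))
      (hint (hM.regularFamily_iter hτ zero_le_one n)), hM.integral_flux_one hτ hτt hψ,
    quadForm_sub, hM.quadForm_iter_succ hτ zero_le_one n hτt hψ, quadForm_one, quadForm_one,
    sub_sub]

lemma quadForm_defectSum_succ (n : ℕ) : quadForm (M.defectSum (n + 1) τ t) ψ
    = quadForm (M.defectSum 0 τ t) ψ + ∫ r in τ..t, M.flux t ψ r (M.defectSum n τ r) := by
  have hint : ∀ k ∈ Finset.range (n + 1),
      IntervalIntegrable (fun r => M.flux t ψ r (1 - M.iter k τ r 1)) volume τ t := fun k _ =>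
    hM.intervalIntegrable_flux hτ le_rfl hτt le_rfl hψ (hM.regularFamily_defect hτ k)
  simp only [defectSum, flux_sum]
  rw [intervalIntegral.integral_finsetSum hint, Finset.sum_range_succ', quadForm_add, quadForm_sum,
    zero_add, Finset.sum_range_one, add_comm]
  simp only [hM.quadForm_defect_succ hτ hτt hψ]

end Defects

section Minorants

variable {X : ℕ → ℝ → H →L[ℂ] H} (hX : M.IsMinorantSequence X)
include hX

lemma monotone_ofReal_quadForm_clampIter (n : ℕ) (s r : ℝ) (χ : H) :
    Monotone fun m => ENNReal.ofReal (quadForm (M.clampIter (X m) n s r) χ) := fun m _ hm =>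
  ENNReal.ofReal_le_ofReal <| quadForm_mono
    (hM.iter_le_iter (le_max_left 0 s) (hX.nonneg m _) (hX.monotone _ hm) n (le_max_left _ r)) χ

lemma ofReal_quadForm_defectSum_zero {τ t : ℝ} (hτ : 0 ≤ τ) (hτt : τ ≤ t) {ψ : H}
    (hψ : ψ ∈ M.D) : ENNReal.ofReal (quadForm (M.defectSum 0 τ t) ψ)
      = ⨆ m, ∫⁻ s in Set.Icc τ t, ENNReal.ofReal (quadForm (M.clampIter (X m) 0 s t) ψ) := by
  rw [hM.quadForm_defectSum_zero hτ hτt hψ, hM.ofReal_integral_flux hτ hτt hψ (.one τ),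
    ← lintegral_iSup
      (fun m => (hM.measurable_quadForm_clampIter_zero (hX.measurable m) t ψ).ennreal_ofReal)
      fun _ _ hm s => hM.monotone_ofReal_quadForm_clampIter hX 0 s t ψ hm]
  refine setLIntegral_congr_fun measurableSet_Icc fun s hs => ?_
  have hs0 := hτ.trans hs.1
  simp only [flux, quadForm_clampIter_zero, max_eq_right hs0, max_eq_right hs.2,
    hX.iSup_quadForm s hs0 _ (hM.W_mem s t hs0 hs.2 ψ hψ)]

variable {n : ℕ} {τ : ℝ} (hτ : 0 ≤ τ) (hn : ∀ r, τ ≤ r → ∀ χ,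
  ENNReal.ofReal (quadForm (M.defectSum n τ r) χ)
    = ⨆ m, ∫⁻ s in Set.Icc τ r, ENNReal.ofReal (quadForm (M.clampIter (X m) n s r) χ))
include hn

lemma lintegral_tsum_defectSum (t : ℝ) {v : ℕ → ℝ → H} (hv : ∀ k, StronglyMeasurable (v k)) :
    ∫⁻ r in Set.Icc τ t, ∑' k, ENNReal.ofReal (quadForm (M.defectSum n τ r) (v k r))
      = ⨆ m, ∫⁻ s in Set.Icc τ t, ∫⁻ r in Set.Icc s t,
        ∑' k, ENNReal.ofReal (quadForm (M.clampIter (X m) n s r) (v k r)) := by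
  have hmono : ∀ s r k, Monotone fun m =>
      ENNReal.ofReal (quadForm (M.clampIter (X m) n s r) (v k r)) := fun s r k =>
    hM.monotone_ofReal_quadForm_clampIter hX n s r (v k r)
  have hmeas : ∀ m r χ, Measurable fun s => quadForm (M.clampIter (X m) n s r) χ := fun m =>
    hM.measurable_quadForm_clampIter (hX.nonneg m) (hX.measurable m) n
  have hjoint := fun m => hM.measurable_tsum_clampIter (hX.nonneg m) (hmeas m) hv
  have hslice : ∀ r ∈ Set.Icc τ t,
      ∑' k, ENNReal.ofReal (quadForm (M.defectSum n τ r) (v k r))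
        = ⨆ m, ∫⁻ s in Set.Icc τ r,
          ∑' k, ENNReal.ofReal (quadForm (M.clampIter (X m) n s r) (v k r)) := fun r hr => by
    simp only [hn r hr.1]
    rw [tsum_iSup_of_monotone fun k _ _ hm => lintegral_mono fun s => hmono s r k hm]
    exact iSup_congr fun m =>
      (lintegral_tsum fun k => (hmeas m r (v k r)).ennreal_ofReal.aemeasurable).symm
  have hmeas_slice : ∀ m, Measurable fun r => ∫⁻ s in Set.Icc τ r,
      ∑' k, ENNReal.ofReal (quadForm (M.clampIter (X m) n s r) (v k r)) := fun m =>
    measurable_setLIntegral_Icc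
      (F := fun r s => ∑' k, ENNReal.ofReal (quadForm (M.clampIter (X m) n s r) (v k r)))
      ((hjoint m).comp measurable_swap) measurable_const measurable_id
  rw [setLIntegral_congr_fun measurableSet_Icc hslice, lintegral_iSup hmeas_slice
    fun _ _ hm r => lintegral_mono fun s => ENNReal.tsum_le_tsum fun k => hmono s r k hm]
  exact iSup_congr fun m => (setLIntegral_triangle_swap (hjoint m) τ t).symm

include hτ in
lemma ofReal_quadForm_defectSum_succ {t : ℝ} (hτt : τ ≤ t) {ψ : H} (hψ : ψ ∈ M.D) :
    ENNReal.ofReal (quadForm (M.defectSum (n + 1) τ t) ψ)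
      = ⨆ m, ∫⁻ s in Set.Icc τ t, ENNReal.ofReal (quadForm (M.clampIter (X m) (n + 1) s t) ψ) := by
  obtain ⟨v, hv⟩ := hM.exists_isKrausFamily (hτ.trans hτt) hψ
  have hreg := hM.regularFamily_defectSum hτ n
  have hmono : Monotone fun m =>
      ∫⁻ s in Set.Icc τ t, ENNReal.ofReal (quadForm (M.clampIter (X m) 0 s t) ψ) := fun _ _ hm =>
    lintegral_mono fun s => hM.monotone_ofReal_quadForm_clampIter hX 0 s t ψ hm
  have hmono_tsum : Monotone fun m => ∫⁻ s in Set.Icc τ t, ∫⁻ r in Set.Icc s t,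
      ∑' k, ENNReal.ofReal (quadForm (M.clampIter (X m) n s r) (v k r)) := fun _ _ hm =>
    lintegral_mono fun s => lintegral_mono fun r => ENNReal.tsum_le_tsum fun k =>
      hM.monotone_ofReal_quadForm_clampIter hX n s r (v k r) hm
  rw [hM.quadForm_defectSum_succ hτ hτt hψ,
    ENNReal.ofReal_add (quadForm_nonneg ((hM.regularFamily_defectSum hτ 0).nonneg t hτt) ψ)
      (integral_flux_nonneg le_rfl hτt hreg),
    hM.ofReal_quadForm_defectSum_zero hX hτ hτt hψ,
    hM.ofReal_integral_flux_eq_tsum hτ hτt hψ hv hreg,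
    hM.lintegral_tsum_defectSum hX hn t hv.stronglyMeasurable,
    ENNReal.iSup_add_iSup_of_monotone hmono hmono_tsum]
  refine iSup_congr fun m => ?_
  rw [← lintegral_add_left
    (hM.measurable_quadForm_clampIter_zero (hX.measurable m) t ψ).ennreal_ofReal]
  refine setLIntegral_congr_fun measurableSet_Icc fun s hs => ?_
  simp only [hM.ofReal_quadForm_clampIter_succ (hX.nonneg m) n s hψ hv,
    max_eq_right (hτ.trans hs.1)]

omit hn in
include hτ in
lemma ofReal_quadForm_defectSum (n : ℕ) {t : ℝ} (hτt : τ ≤ t) (χ : H) :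
    ENNReal.ofReal (quadForm (M.defectSum n τ t) χ)
      = ⨆ m, ∫⁻ s in Set.Icc τ t, ENNReal.ofReal (quadForm (M.clampIter (X m) n s t) χ) := by
  have hextend : ∀ {n t}, (∀ ψ ∈ M.D, ENNReal.ofReal (quadForm (M.defectSum n τ t) ψ)
      = ⨆ m, ∫⁻ s in Set.Icc τ t, ENNReal.ofReal (quadForm (M.clampIter (X m) n s t) ψ)) →
      ∀ χ, ENNReal.ofReal (quadForm (M.defectSum n τ t) χ)
        = ⨆ m, ∫⁻ s in Set.Icc τ t, ENNReal.ofReal (quadForm (M.clampIter (X m) n s t) χ) :=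
    fun {n t} => ofReal_quadForm_eq_iSup_of_dense (Y := fun m s => M.clampIter (X m) n s t)
      hM.dense_D (fun m s => hM.clampIter_nonneg (hX.nonneg m) n s t)
      fun m => hM.measurable_quadForm_clampIter (hX.nonneg m) (hX.measurable m) n t
  induction n generalizing t χ with
  | zero => exact hextend (fun ψ hψ => hM.ofReal_quadForm_defectSum_zero hX hτ hτt hψ) χ
  | succ n ih =>
    exact hextend (fun ψ hψ => hM.ofReal_quadForm_defectSum_succ hX hτ (fun r => ih) hτt hψ) χ

end Minorants

variable {τ t : ℝ} (hτ : 0 ≤ τ) (hτt : τ ≤ t)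
include hτ hτt

lemma ofReal_quadForm_defectSum_le (n : ℕ) (χ : H) :
    ENNReal.ofReal (quadForm (M.defectSum n τ t) χ) ≤ M.intForm τ t χ := by
  obtain ⟨X, hX⟩ := hM.exists_isMinorantSequence
  rw [hM.ofReal_quadForm_defectSum hX hτ n hτt]
  refine iSup_le fun m => setLIntegral_mono' measurableSet_Icc fun s hs => ?_
  have hs0 := hτ.trans hs.1
  rw [clampIter_of_le (X m) n hs0 hs.2]
  calc ENNReal.ofReal (quadForm (M.iter n s t (X m s)) χ)
      ≤ ENNReal.ofReal (quadForm (M.pMin s t (X m s)) χ) :=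
        ENNReal.ofReal_le_ofReal
          (quadForm_mono (hM.iter_le_pMin hs0 (hX.nonneg m s) n hs.2) χ)
    _ ≤ M.pMinPhi s t χ :=
        le_iSup₂ (f := fun Z (_ : Z ∈ M.minorants s) => ENNReal.ofReal (quadForm (M.pMin s t Z) χ))
          (X m s) (hX.mem_minorants m s hs0)

lemma succ_mul_quadForm_one_sub_pMin_le (n : ℕ) (χ : H) :
    (n + 1) * quadForm (1 - M.pMin τ t 1) χ ≤ quadForm (M.defectSum n τ t) χ := by
  have h := Finset.card_nsmul_le_sum (Finset.range (n + 1))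
    (fun k => quadForm (1 - M.iter k τ t 1) χ) (quadForm (1 - M.pMin τ t 1) χ) fun k _ =>
      quadForm_mono (sub_le_sub_left (hM.iter_le_pMin hτ zero_le_one k hτt) 1) χ
  rw [Finset.card_range, nsmul_eq_mul, Nat.cast_succ] at h
  rwa [defectSum, quadForm_sum]

lemma quadForm_one_sub_pMin_nonpos {χ : H} (hχ : M.intForm τ t χ < ⊤) :
    quadForm (1 - M.pMin τ t 1) χ ≤ 0 := by
  by_contra! hpos
  obtain ⟨n, hn⟩ := exists_nat_gt ((M.intForm τ t χ).toReal / quadForm (1 - M.pMin τ t 1) χ)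
  rw [div_lt_iff₀ hpos] at hn
  have hle : (n + 1) * quadForm (1 - M.pMin τ t 1) χ ≤ (M.intForm τ t χ).toReal :=
    (hM.succ_mul_quadForm_one_sub_pMin_le hτ hτt n χ).trans
      ((ENNReal.ofReal_le_iff_le_toReal hχ.ne).1 (hM.ofReal_quadForm_defectSum_le hτ hτt n χ))
  linarith

lemma pMin_one_le_one : M.pMin τ t 1 ≤ 1 :=
  (hM.isLUB_pMin hτ zero_le_one hτt).2 <| by
    rintro _ ⟨n, rfl⟩
    exact hM.iter_one_le_one hτ n hτt

end Assumptions

end Data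

end MarkovMaster

end

open MarkovMaster in
theorem theorem1p1_general {H : Type*} [NormedAddCommGroup H] [InnerProductSpace ℂ H]
    [CompleteSpace H] {M : MarkovMaster.Data H} (hM : M.Assumptions) {τ t : ℝ} (hτ : 0 ≤ τ)
    (hτt : τ ≤ t) (hdense : Dense {ψ | M.intForm τ t ψ < ⊤}) : M.pMin τ t 1 = 1 := by
  have hdefect : 0 ≤ 1 - M.pMin τ t 1 := sub_nonneg.2 (hM.pMin_one_le_one hτ hτt)
  refine le_antisymm (hM.pMin_one_le_one hτ hτt) (sub_nonpos.1 ?_)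
  refine le_of_forall_mem_dense hdense hdefect.isSelfAdjoint (.zero _) fun ψ hψ => ?_
  rw [quadForm_zero]
  exact hM.quadForm_one_sub_pMin_nonpos hτ hτt hψ

/-- If the operator `∫_τ^t P^min_{s,t} Φₛ(I) ds` is densely defined, then the minimal solution of
the Markov master equation is unital: `P^min_{τ,t}(I) = I`. -/
theorem theorem1p1 {H : Type*} [NormedAddCommGroup H] [InnerProductSpace ℂ H] [CompleteSpace H]
    [TopologicalSpace.SeparableSpace H] (M : MarkovMaster.Data H) (hM : M.Assumptions)
    (τ t : ℝ) (hτ : 0 ≤ τ) (hτt : τ ≤ t)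
    (hdense : Dense (MarkovMaster.opDomain (M.intForm τ t))) :
    M.pMin τ t 1 = 1 :=
  theorem1p1_general hM hτ hτt (hdense.mono fun _ hψ => hψ.1)
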